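/- Let $\mathscr L$ be the language of Peano arithmetic (function symbols $0,S,+,\cdot$, with equality), and let $\mathscr L(K)$ be the first-order language obtained from $\mathscr L$ by adding, inductively, for every formula $\phi$ of $\mathscr L(K)$ (with or without free variables) a new $0$-ary predicate symbol, written $K(\phi)$. For an $\mathscr L(K)$-structure $\mathscr M$ and a formula $\phi$, write $\mathscr M\models\phi$ if $\phi$ is true in $\mathscr M$ under every assignment; $\mathscr M\models T$ if $\mathscr M\models\phi$ for all $\phi\in T$; and $T\models\phi$ if every $\mathscr L(K)$-structure $\mathscr M$ with $\mathscr M\models T$ satisfies $\mathscr M\models\phi$. A formula is a tautology if it is true in every $\mathscr L(K)$-structure under every assignment. The axioms of PA are the usual basic axioms for $0,S,+,\cdot$ and the universal closures of the induction formulas for $\mathscr L$-formulas. The axioms of a knowing machine are the following, for all formulas $\phi,\psi$ of $\mathscr L(K)$: (1) Knowledge of Tautology: $K(\phi)$ whenever $\phi$ is a tautology; (2) Knowledge Modus Ponens: $K(\phi\to\psi)\to K(\phi)\to K(\psi)$; (3) Knowledge of Arithmetic: $K(\phi)$ whenever $\phi$ is an axiom of PA; (4) Closure: $K(\phi)$ whenever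 $\phi$ is an instance of (1), (2) or (3); (5) Factivity: $K(\phi)\to\phi$. Call an $\mathscr L(K)$-structure standard if its universe is $\mathbb N$ and it interprets the symbols of PA as usual. A knowing entity is a standard structure satisfying (1)–(5). A knowing machine is a knowing entity $\mathscr M$ for which the set $\{\ulcorner\phi\urcorner : \mathscr M\models K(\phi)\}$ of Gödel numbers of the formulas it knows is recursively enumerable. Let $\Sigma$ be the set of axioms of a knowing machine together with the axioms of PA. Theorem. There is exactly one standard structure, denoted $\mathrm{Slash}(\Sigma)$, such that for every formula $\phi$ of $\mathscr L(K)$, $$\mathrm{Slash}(\Sigma)\models K(\phi)\iff \mathrm{Slash}(\Sigma)\models\phi\ \text{ and }\ \Sigma\models\phi .$$ Moreover: (a) $\mathrm{Slash}(\Sigma)\models\Sigma$; (b) $\mathrm{Slash}(\Sigma)$ possesses Knowledge of Factivity: $\mathrm{Slash}(\Sigma)\models K(K(\phi)\to\phi)$ for every formula $\phi$; (c) for every formula $\phi$, $\mathrm{Slash}(\Sigma)\models K(\phi)$ if and only if $\Sigma\models\phi$; hence $\{\ulcorner\phi\urcorner : \mathrm{Slash}(\Sigma)\models K(\phi)\}=\{\ulcorner\phi\urcorner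 : \Sigma\models\phi\}$, and this set is recursively enumerable; (d) $\mathrm{Slash}(\Sigma)$ is a knowing machine. In particular, there is a knowing machine which possesses Knowledge of Factivity. -/

import Mathlib

namespace KnowingMachine

/-! ### First-order languages weakly extended by a knowledge operator -/

/-- The formulas of `L(K)`, the first-order language `L` weakly extended by `K`. The symbols and the
formulas of `L(K)` are generated simultaneously: every formula `φ` of `L(K)` gives a new
`0`-ary predicate symbol `K_φ`, which is the atomic formula `know φ`. The individual variables are
indexed by `ℕ`; the terms of `L(K)` are those of `L`. -/
inductive KFormula (L : FirstOrder.Language.{0, 0}) : Type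
  | falsum : KFormula L
  | equal (t₁ t₂ : L.Term ℕ) : KFormula L
  | rel {n : ℕ} (R : L.Relations n) (ts : Fin n → L.Term ℕ) : KFormula L
  | imp (φ ψ : KFormula L) : KFormula L
  | all (x : ℕ) (φ : KFormula L) : KFormula L
  | know (φ : KFormula L) : KFormula L

/-- An `L(K)`-structure: an `L`-structure on a nonempty universe, together with a truth value for
each `0`-ary predicate symbol `K_φ` (`known` is the set of the `φ` for which `K_φ` is true).
As the languages below are countable, universes in `Type` suffice for validity and consequence. -/
structure KStructure (L : FirstOrder.Language.{0, 0}) where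
  carrier : Type
  nonempty : Nonempty carrier
  str : L.Structure carrier
  known : Set (KFormula L)

attribute [instance] KStructure.nonempty KStructure.str

section Semantics

variable {L : FirstOrder.Language.{0, 0}}

/-- `M.Sat s φ`: the structure `M` satisfies `φ` under the assignment `s`. -/
def KStructure.Sat (M : KStructure L) (s : ℕ → M.carrier) : KFormula L → Prop
  | .falsum => False
  | .equal t₁ t₂ => t₁.realize s = t₂.realize s
  | .rel R ts => FirstOrder.Language.Structure.RelMap R fun i => (ts i).realize s
  | .imp φ ψ => M.Sat s φ → M.Sat s ψ
  | .all x φ => ∀ a : M.carrier, M.Sat (Function.update s x a) φ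
  | .know φ => φ ∈ M.known

/-- `M ⊨ φ`: the formula `φ` is true in `M` under every assignment. -/
def KStructure.Models (M : KStructure L) (φ : KFormula L) : Prop :=
  ∀ s : ℕ → M.carrier, M.Sat s φ

/-- `M ⊨ T` for a set `T` of formulas. -/
def KStructure.ModelsAll (M : KStructure L) (T : Set (KFormula L)) : Prop :=
  ∀ φ ∈ T, M.Models φ

/-- `T ⊨ φ`: every model of `T` is a model of `φ`. -/
def Entails (T : Set (KFormula L)) (φ : KFormula L) : Prop :=
  ∀ M : KStructure L, M.ModelsAll T → M.Models φ

/-- Tautologies of first-order logic: formulas true in every structure under every assignment. -/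
def Tautology (φ : KFormula L) : Prop :=
  ∀ M : KStructure L, M.Models φ

namespace KFormula

/-- Negation. -/
def neg (φ : KFormula L) : KFormula L := imp φ falsum

/-- The set of free variables; `K_φ` is a `0`-ary predicate symbol and has none. -/
def freeVars : KFormula L → Finset ℕ
  | falsum => ∅
  | equal t₁ t₂ => t₁.varFinset ∪ t₂.varFinset
  | rel _ ts => Finset.univ.biUnion fun i => (ts i).varFinset
  | imp φ ψ => φ.freeVars ∪ ψ.freeVars
  | all x φ => φ.freeVars.erase x
  | know _ => ∅

/-- `φ.subst x t` is `φ(x|t)`: the free occurrences of `x` are replaced by `t`, without renaming of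
bound variables. (It is used only for terms `t` whose variables are among `{x}`, so that no
variable can be captured.) As `K_φ` has no variables, it is left unchanged. -/
def subst (x : ℕ) (t : L.Term ℕ) : KFormula L → KFormula L
  | falsum => falsum
  | equal t₁ t₂ =>
      equal (t₁.subst (Function.update FirstOrder.Language.Term.var x t))
        (t₂.subst (Function.update FirstOrder.Language.Term.var x t))
  | rel R ts => rel R fun i => (ts i).subst (Function.update FirstOrder.Language.Term.var x t)
  | imp φ ψ => imp (φ.subst x t) (ψ.subst x t)
  | all y φ => all y (if y = x then φ else φ.subst x t)
  | know φ => know φ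

/-- Formulas of the base language `L`: those in which no symbol `K_φ` occurs. -/
def KFree : KFormula L → Prop
  | falsum => True
  | equal _ _ => True
  | rel _ _ => True
  | imp φ ψ => φ.KFree ∧ ψ.KFree
  | all _ φ => φ.KFree
  | know _ => False

/-- `allList [x₁, …, xₙ] φ` is `∀ x₁ … ∀ xₙ φ`. -/
def allList (xs : List ℕ) (φ : KFormula L) : KFormula L := xs.foldr all φ

end KFormula

end Semantics

/-! ### Peano arithmetic -/

/-- The function symbols `0`, `S`, `+`, `·` of Peano arithmetic. -/
inductive PAFunc : ℕ → Type
  | zero : PAFunc 0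
  | succ : PAFunc 1
  | add : PAFunc 2
  | mul : PAFunc 2

/-- The language of Peano arithmetic: function symbols `0`, `S`, `+`, `·`, and equality. -/
def langPA : FirstOrder.Language.{0, 0} where
  Functions := PAFunc
  Relations := fun _ => Empty

/-- The terms of the language of Peano arithmetic. -/
abbrev PATerm : Type := langPA.Term ℕ

/-- The formulas of `L(K)`, where from now on `L` is the language of Peano arithmetic. -/
abbrev Form : Type := KFormula langPA

namespace PATerm

/-- The variable with index `x`, as a term. -/
def v (x : ℕ) : PATerm := FirstOrder.Language.Term.var x

/-- The term `0`. -/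
def zero : PATerm := FirstOrder.Language.Term.func (L := langPA) PAFunc.zero ![]

/-- The term `S t`. -/
def succ (t : PATerm) : PATerm := FirstOrder.Language.Term.func (L := langPA) PAFunc.succ ![t]

/-- The term `t + u`. -/
def add (t u : PATerm) : PATerm := FirstOrder.Language.Term.func (L := langPA) PAFunc.add ![t, u]

/-- The term `t · u`. -/
def mul (t u : PATerm) : PATerm := FirstOrder.Language.Term.func (L := langPA) PAFunc.mul ![t, u]

end PATerm

open KFormula PATerm in
/-- The induction formula `φ(x|0) → ∀ x (φ → φ(x|S x)) → ∀ x φ`. -/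
def induction (x : ℕ) (φ : Form) : Form :=
  imp (φ.subst x zero) (imp (all x (imp φ (φ.subst x (succ (v x))))) (all x φ))

open KFormula PATerm in
/-- The axioms of Peano arithmetic: the six basic axioms and the universal closures of the
induction formulas for formulas of the language of arithmetic. -/
inductive IsPAAxiom : Form → Prop
  | succ_ne_zero : IsPAAxiom (all 0 (neg (equal (succ (v 0)) zero)))
  | succ_inj : IsPAAxiom (all 0 (all 1 (imp (equal (succ (v 0)) (succ (v 1))) (equal (v 0) (v 1)))))
  | add_zero : IsPAAxiom (all 0 (equal (add (v 0) zero) (v 0)))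
  | add_succ : IsPAAxiom (all 0 (all 1
      (equal (add (v 0) (succ (v 1))) (succ (add (v 0) (v 1))))))
  | mul_zero : IsPAAxiom (all 0 (equal (mul (v 0) zero) zero))
  | mul_succ : IsPAAxiom (all 0 (all 1
      (equal (mul (v 0) (succ (v 1))) (add (mul (v 0) (v 1)) (v 0)))))
  | ind (x : ℕ) (φ : Form) (hφ : φ.KFree) (xs : List ℕ)
      (hxs : (induction x φ).freeVars ⊆ xs.toFinset) : IsPAAxiom (allList xs (induction x φ))

/-- The usual interpretation of the symbols of Peano arithmetic in `ℕ`. -/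
instance stdPA : langPA.Structure ℕ where
  funMap := fun {_} f =>
    match f with
    | PAFunc.zero => fun _ => 0
    | PAFunc.succ => fun a => a 0 + 1
    | PAFunc.add => fun a => a 0 + a 1
    | PAFunc.mul => fun a => a 0 * a 1
  RelMap := fun {_} R _ => R.elim

/-- The `L(K)`-structure with universe `ℕ` that interprets the symbols of Peano arithmetic as usual
and in which `K(φ)` is true exactly for `φ ∈ k`. -/
abbrev standard (k : Set Form) : KStructure langPA where
  carrier := ℕ
  nonempty := ⟨0⟩
  str := stdPA
  known := k

/-- `M` has universe `ℕ` and interprets the symbols of Peano arithmetic as usual. -/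
def IsStandard (M : KStructure langPA) : Prop := ∃ k : Set Form, M = standard k

/-! ### Knowing entities and knowing machines -/

open KFormula in
/-- The instances of Knowledge of Tautology, Knowledge Modus Ponens and Knowledge of Arithmetic. -/
inductive IsBasicAxiom : Form → Prop
  | tautology (φ : Form) (h : Tautology φ) : IsBasicAxiom (know φ)
  | modusPonens (φ ψ : Form) : IsBasicAxiom (imp (know (imp φ ψ)) (imp (know φ) (know ψ)))
  | arithmetic (φ : Form) (h : IsPAAxiom φ) : IsBasicAxiom (know φ)

open KFormula in
/-- The axioms of a knowing machine: the basic axioms; Closure, i.e. `K(φ)` for each basic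
axiom `φ`; and Factivity, i.e. `K(φ) → φ` for each formula `φ`. -/
inductive IsKnowingAxiom : Form → Prop
  | basic (φ : Form) (h : IsBasicAxiom φ) : IsKnowingAxiom φ
  | closure (φ : Form) (h : IsBasicAxiom φ) : IsKnowingAxiom (know φ)
  | factivity (φ : Form) : IsKnowingAxiom (imp (know φ) φ)

/-- The set of the axioms of a knowing machine. -/
def knowingAxioms : Set Form := {φ | IsKnowingAxiom φ}

/-- The theory `Σ`: the axioms of a knowing machine together with the axioms of Peano arithmetic. -/
def knowingPA : Set Form := knowingAxioms ∪ {φ | IsPAAxiom φ}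

/-- Gödel numbers of terms. -/
def codeTerm : PATerm → ℕ
  | .var x => Nat.pair 0 x
  | .func PAFunc.zero _ => Nat.pair 1 0
  | .func PAFunc.succ ts => Nat.pair 2 (codeTerm (ts 0))
  | .func PAFunc.add ts => Nat.pair 3 (Nat.pair (codeTerm (ts 0)) (codeTerm (ts 1)))
  | .func PAFunc.mul ts => Nat.pair 4 (Nat.pair (codeTerm (ts 0)) (codeTerm (ts 1)))

/-- Gödel numbers of formulas of `L(K)`. -/
def code : Form → ℕ
  | .falsum => Nat.pair 0 0
  | .equal t₁ t₂ => Nat.pair 1 (Nat.pair (codeTerm t₁) (codeTerm t₂))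
  | .rel R _ => Empty.elim R
  | .imp φ ψ => Nat.pair 2 (Nat.pair (code φ) (code ψ))
  | .all x φ => Nat.pair 3 (Nat.pair x (code φ))
  | .know φ => Nat.pair 4 (code φ)

/-- A knowing entity: a structure with universe `ℕ` that interprets the symbols of Peano arithmetic
as usual and satisfies the axioms of a knowing machine. -/
def IsKnowingEntity (M : KStructure langPA) : Prop :=
  IsStandard M ∧ M.ModelsAll knowingAxioms

/-- The set of Gödel numbers of the formulas known by `M`. -/
def knownCodes (M : KStructure langPA) : Set ℕ := {n | ∃ φ : Form, code φ = n ∧ M.Models φ.know}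

/-- The set of Gödel numbers of the consequences of `T`. -/
def consequenceCodes (T : Set Form) : Set ℕ := {n | ∃ φ : Form, code φ = n ∧ Entails T φ}

/-- A knowing machine: a knowing entity that knows a recursively enumerable set of formulas. -/
def IsKnowingMachine (M : KStructure langPA) : Prop :=
  IsKnowingEntity M ∧ REPred fun n : ℕ => n ∈ knownCodes M

/-- Knowledge of Factivity: the schema `K(K(φ) → φ)`. -/
def KnowsFactivity (M : KStructure langPA) : Prop :=
  ∀ φ : Form, M.Models (KFormula.know (KFormula.imp (KFormula.know φ) φ))

/-! ### The structure `Slash(T)` -/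

/-- Truth in `Slash(T)` under an assignment, by recursion on the formula; `K(φ)` is true
if `φ` is true under every assignment and `T ⊨ φ`. -/
def slashSat (T : Set Form) : (ℕ → ℕ) → Form → Prop
  | _, .falsum => False
  | s, .equal t₁ t₂ => t₁.realize s = t₂.realize s
  | _, .rel R _ => Empty.elim R
  | s, .imp φ ψ => slashSat T s φ → slashSat T s ψ
  | s, .all x φ => ∀ a : ℕ, slashSat T (Function.update s x a) φ
  | _, .know φ => (∀ s : ℕ → ℕ, slashSat T s φ) ∧ Entails T φ

/-- `Slash(T)`: universe `ℕ`, the usual interpretation of the symbols of Peano arithmetic, and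
`K(φ)` true if and only if `φ` is true in `Slash(T)` and `T ⊨ φ`. -/
def slash (T : Set Form) : KStructure langPA :=
  standard {φ | (∀ s : ℕ → ℕ, slashSat T s φ) ∧ Entails T φ}

end KnowingMachine

open KnowingMachine

/-!
Let `Σ` be `knowingPA`. By induction on formulas the defining equivalence of `Slash(Σ)` determines
which formulas are true in a standard structure, which gives uniqueness (`standard_eq_slash`). Every
axiom in `Σ` is true in `Slash(Σ)` (`slash_modelsAll`): an axiom of the form `K(φ)` asks that `φ` be
true in `Slash(Σ)` and a consequence of `Σ`, modus ponens holds because truth and consequence are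
both closed under it, and Factivity holds because `K(φ)` requires the truth of `φ`. Hence every
consequence of `Σ` is true in `Slash(Σ)`, so that `K(φ)` says no more than `Σ ⊨ φ`
(`slash_models_know_iff`), and Factivity, itself in `Σ`, is known.

It remains to see that the consequences of `Σ` are recursively enumerable. In place of a proof
calculus, the argument uses the Henkin construction and the compactness of the Cantor space
directly. A countermodel to `Σ ⊨ φ` can be cut down to the elements named by terms with witness
constants, and is then described by a truth valuation `v : ℕ → Bool` on pairs (formula code, code of
an assignment of names). Conversely, a valuation that obeys Tarski's conditions, with a witness for
each false universal formula, yields a model on the names modulo equality. So `Σ ⊨ φ` if and only if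
no valuation satisfies a certain primitive recursive sequence of propositional clauses
(`entails_iff`, `isTruth_iff`), and by compactness this is a `Σ₁` condition (`sigmaOne_unsat`).
The argument applies to every theory whose axioms are recursively enumerable (`sigmaOne_entails`).
It is used twice: for the empty theory, since the tautologies enter into the axioms of `Σ`, and for
`Σ` itself.

Names are term codes, so that evaluating a term under an assignment of names is substitution. All
syntactic operations are instances of one recursion on tagged pairs, `codeRec`, which preserves
primitive recursiveness (`primrec_codeRec`).
-/

namespace KnowingMachine

/-! ### Primitive recursive functions and `Σ₁` predicates -/

section PrimrecTools

variable {α : Type*} [Primcodable α]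

attribute [fun_prop] Primrec
attribute [fun_prop] Primrec.const Primrec.id Primrec.comp Primrec.pair

@[fun_prop]
theorem primrec_fst {β γ : Type*} [Primcodable β] [Primcodable γ] {f : α → β × γ}
    (hf : Primrec f) : Primrec fun a => (f a).1 := Primrec.fst.comp hf

@[fun_prop]
theorem primrec_snd {β γ : Type*} [Primcodable β] [Primcodable γ] {f : α → β × γ}
    (hf : Primrec f) : Primrec fun a => (f a).2 := Primrec.snd.comp hf

@[fun_prop]
theorem primrec_pair {f g : α → ℕ} (hf : Primrec f) (hg : Primrec g) :
    Primrec fun a => Nat.pair (f a) (g a) := Primrec₂.natPair.comp hf hg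

@[fun_prop]
theorem primrec_unpair {f : α → ℕ} (hf : Primrec f) : Primrec fun a => Nat.unpair (f a) :=
  Primrec.unpair.comp hf

@[fun_prop]
theorem primrec_add {f g : α → ℕ} (hf : Primrec f) (hg : Primrec g) :
    Primrec fun a => f a + g a := Primrec.nat_add.comp hf hg

@[fun_prop]
theorem primrec_sub {f g : α → ℕ} (hf : Primrec f) (hg : Primrec g) :
    Primrec fun a => f a - g a := Primrec.nat_sub.comp hf hg

@[fun_prop]
theorem primrec_ite {σ : Type*} [Primcodable σ] {f g : α → ℕ} {u v : α → σ} (hf : Primrec f)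
    (hg : Primrec g) (hu : Primrec u) (hv : Primrec v) :
    Primrec fun a => if f a = g a then u a else v a :=
  Primrec.ite (Primrec.eq.comp hf hg) hu hv

@[fun_prop]
theorem primrec_decide_eq {f g : α → ℕ} (hf : Primrec f) (hg : Primrec g) :
    Primrec fun a => decide (f a = g a) :=
  PrimrecPred.decide (Primrec.eq.comp hf hg)

@[fun_prop]
theorem primrec_and {f g : α → Bool} (hf : Primrec f) (hg : Primrec g) :
    Primrec fun a => f a && g a := Primrec.and.comp hf hg

@[fun_prop]
theorem primrec_or {f g : α → Bool} (hf : Primrec f) (hg : Primrec g) :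
    Primrec fun a => f a || g a := Primrec.or.comp hf hg

@[fun_prop]
theorem primrec_not {f : α → Bool} (hf : Primrec f) :
    Primrec fun a => !f a := Primrec.not.comp hf

@[fun_prop]
theorem primrec_cons {β : Type*} [Primcodable β] {f : α → β} {g : α → List β} (hf : Primrec f)
    (hg : Primrec g) : Primrec fun a => f a :: g a :=
  Primrec.list_cons.comp hf hg

end PrimrecTools

/-- Projections of primitive recursive relations, i.e. `Σ₁` predicates. -/
def SigmaOne (P : ℕ → Prop) : Prop :=
  ∃ R : ℕ → ℕ → Bool, (Primrec fun p : ℕ × ℕ => R p.1 p.2) ∧ ∀ n, P n ↔ ∃ m, R n m = true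

namespace SigmaOne

variable {P Q : ℕ → Prop}

theorem rePred (h : SigmaOne P) : REPred P := by
  obtain ⟨R, hR, hP⟩ := h
  have h1 : Partrec fun n : ℕ => Nat.rfind fun m => Part.some (R n m) :=
    Partrec.rfind (p := fun n m => Part.some (R n m)) hR.to_comp.partrec
  refine h1.dom_re.of_eq fun n => ?_
  refine Nat.rfind_dom.trans ((hP n).trans ?_).symm
  simp

theorem of_eq (h : SigmaOne P) (hPQ : ∀ n, Q n ↔ P n) : SigmaOne Q :=
  (funext fun n => propext (hPQ n) : Q = P) ▸ h

theorem of_primrec {f : ℕ → Bool} (hf : Primrec f) : SigmaOne fun n => f n = true :=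
  ⟨fun n _ => f n, hf.comp Primrec.fst, fun n => by simp⟩

theorem comp (h : SigmaOne P) {f : ℕ → ℕ} (hf : Primrec f) : SigmaOne fun n => P (f n) := by
  obtain ⟨R, hR, hP⟩ := h
  exact ⟨fun n m => R (f n) m, hR.comp ((hf.comp Primrec.fst).pair Primrec.snd), fun n => hP _⟩

theorem or (hP : SigmaOne P) (hQ : SigmaOne Q) : SigmaOne fun n => P n ∨ Q n := by
  obtain ⟨R, hR, hP⟩ := hP
  obtain ⟨S, hS, hQ⟩ := hQ
  refine ⟨fun n m => R n m || S n m, Primrec.or.comp hR hS, fun n => ?_⟩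
  simp only [hP, hQ, Bool.or_eq_true, exists_or]

theorem and (hP : SigmaOne P) (hQ : SigmaOne Q) : SigmaOne fun n => P n ∧ Q n := by
  obtain ⟨R, hR, hP⟩ := hP
  obtain ⟨S, hS, hQ⟩ := hQ
  have hR' : Primrec fun p : ℕ × ℕ => R p.1 p.2.unpair.1 :=
    hR.comp (g := fun p : ℕ × ℕ => (p.1, p.2.unpair.1)) (by fun_prop)
  have hS' : Primrec fun p : ℕ × ℕ => S p.1 p.2.unpair.2 :=
    hS.comp (g := fun p : ℕ × ℕ => (p.1, p.2.unpair.2)) (by fun_prop)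
  refine ⟨fun n m => R n m.unpair.1 && S n m.unpair.2, Primrec.and.comp hR' hS', fun n => ?_⟩
  simp only [hP, hQ, Bool.and_eq_true]
  constructor
  · rintro ⟨⟨i, hi⟩, j, hj⟩
    exact ⟨Nat.pair i j, by simpa using ⟨hi, hj⟩⟩
  · rintro ⟨m, hi, hj⟩
    exact ⟨⟨_, hi⟩, _, hj⟩

/-- `Σ₁` predicates are closed under existential quantification. -/
theorem exists_pair (h : SigmaOne P) : SigmaOne fun n => ∃ w, P (Nat.pair n w) := by
  obtain ⟨R, hR, hP⟩ := h
  refine ⟨fun n m => R (Nat.pair n m.unpair.1) m.unpair.2,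
    hR.comp (g := fun p : ℕ × ℕ => (Nat.pair p.1 p.2.unpair.1, p.2.unpair.2)) (by fun_prop),
    fun n => ?_⟩
  simp only [hP]
  constructor
  · rintro ⟨w, m, h⟩
    exact ⟨Nat.pair w m, by simpa using h⟩
  · rintro ⟨m, h⟩
    exact ⟨_, _, h⟩

end SigmaOne

/-! ### Recursion on tagged pairs -/

theorem le_pair_right (k m : ℕ) : m ≤ Nat.pair k m := Nat.right_le_pair k m

theorem unpair_snd_lt {n : ℕ} (h : n.unpair.1 ≠ 0) : n.unpair.2 < n := by
  have := Nat.add_le_pair n.unpair.1 n.unpair.2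
  rw [Nat.pair_unpair] at this
  omega

/-- Recursion along the coding of syntax trees as tagged pairs, where `⟨k, m⟩` stands for
`Nat.pair k m`: a number `⟨0, m⟩` is a leaf with label `m`, while for `k ≠ 0` the value at
`⟨k, m⟩` may depend on the values at `m` and at the two components of `m`. -/
def codeRec {σ : Type*} (B : ℕ → σ) (G : ℕ → ℕ → σ → σ → σ → σ) (n : ℕ) : σ :=
  if _h : n.unpair.1 = 0 then B n.unpair.2
  else G n.unpair.1 n.unpair.2 (codeRec B G n.unpair.2) (codeRec B G n.unpair.2.unpair.1)
    (codeRec B G n.unpair.2.unpair.2)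
termination_by n
decreasing_by
  · exact unpair_snd_lt ‹_›
  · exact (Nat.unpair_left_le _).trans_lt (unpair_snd_lt ‹_›)
  · exact (Nat.unpair_right_le _).trans_lt (unpair_snd_lt ‹_›)

section CodeRec

variable {σ : Type*} (B : ℕ → σ) (G : ℕ → ℕ → σ → σ → σ → σ)

theorem codeRec_leaf (m : ℕ) : codeRec B G (Nat.pair 0 m) = B m := by
  rw [codeRec]; simp

theorem codeRec_node {k : ℕ} (hk : k ≠ 0) (m : ℕ) :
    codeRec B G (Nat.pair k m) =
      G k m (codeRec B G m) (codeRec B G m.unpair.1) (codeRec B G m.unpair.2) := by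
  rw [codeRec]; simp [hk]

/-- The induction principle that goes with `codeRec`. -/
theorem code_induction {C : ℕ → Prop} (leaf : ∀ m, C (Nat.pair 0 m))
    (node : ∀ k m, k ≠ 0 → C m → C m.unpair.1 → C m.unpair.2 → C (Nat.pair k m)) (n : ℕ) :
    C n := by
  induction n using Nat.strong_induction_on with
  | _ n ih =>
    rw [← Nat.pair_unpair n]
    by_cases h : n.unpair.1 = 0
    · rw [h]; exact leaf _
    · have h2 := unpair_snd_lt h
      exact node _ _ h (ih _ h2) (ih _ ((Nat.unpair_left_le _).trans_lt h2))
        (ih _ ((Nat.unpair_right_le _).trans_lt h2))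

end CodeRec

theorem primrec_codeRec {α σ : Type*} [Primcodable α] [Primcodable σ] [Inhabited σ]
    {B : α → ℕ → σ} {G : α → ℕ → ℕ → σ → σ → σ → σ}
    (hB : Primrec fun q : α × ℕ => B q.1 q.2)
    (hG : Primrec fun q : α × ℕ × ℕ × σ × σ × σ =>
      G q.1 q.2.1 q.2.2.1 q.2.2.2.1 q.2.2.2.2.1 q.2.2.2.2.2)
    {f : α → ℕ} (hf : Primrec f) : Primrec fun a => codeRec (B a) (G a) (f a) := by
  have key : Primrec₂ fun (a : α) n => codeRec (B a) (G a) n := by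
    -- One step of the recursion, from the list `l` of the values at all smaller numbers.
    let step : α → List σ → σ := fun a l =>
      if l.length.unpair.1 = 0 then B a l.length.unpair.2
      else G a l.length.unpair.1 l.length.unpair.2 (l.getI l.length.unpair.2)
        (l.getI l.length.unpair.2.unpair.1) (l.getI l.length.unpair.2.unpair.2)
    have hget : ∀ {h : α × List σ → ℕ}, Primrec h → Primrec fun p : α × List σ => p.2.getI (h p) :=
      fun hh => Primrec.list_getI.comp Primrec.snd hh
    have hlen : Primrec fun p : α × List σ => p.2.length := Primrec.list_length.comp Primrec.snd
    have hstep : Primrec fun p : α × List σ => step p.1 p.2 := by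
      refine primrec_ite (by fun_prop) (by fun_prop) ?_ ?_
      · exact hB.comp (g := fun p : α × List σ => (p.1, p.2.length.unpair.2)) (by fun_prop)
      · exact hG.comp (g := fun p : α × List σ => (p.1, p.2.length.unpair.1, p.2.length.unpair.2,
          p.2.getI p.2.length.unpair.2, p.2.getI p.2.length.unpair.2.unpair.1,
          p.2.getI p.2.length.unpair.2.unpair.2))
          (Primrec.fst.pair <| (by fun_prop : Primrec _).pair <| (by fun_prop : Primrec _).pair <|
            (hget (by fun_prop)).pair <| (hget (by fun_prop)).pair <| hget (by fun_prop))
    refine Primrec.nat_strong_rec _ (g := fun a l => some (step a l))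
      (Primrec.option_some.comp hstep) fun a n => ?_
    have hI : ∀ i < n, (List.map (fun n => codeRec (B a) (G a) n) (List.range n)).getI i =
        codeRec (B a) (G a) i := by
      intro i hi
      rw [List.getI_eq_getElem _ (by simpa using hi)]
      simp
    simp only [step, List.length_map, List.length_range, Option.some.injEq]
    conv_rhs => rw [codeRec]
    split_ifs with h
    · rfl
    · have h2 := unpair_snd_lt h
      rw [hI _ h2, hI _ ((Nat.unpair_left_le _).trans_lt h2),
        hI _ ((Nat.unpair_right_le _).trans_lt h2)]
  exact key.comp Primrec.id hf

/-! ### Terms and formulas of arithmetic -/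

theorem term_induction {C : PATerm → Prop} (var : ∀ x, C (PATerm.v x)) (zero : C PATerm.zero)
    (succ : ∀ t, C t → C (PATerm.succ t)) (add : ∀ t u, C t → C u → C (PATerm.add t u))
    (mul : ∀ t u, C t → C u → C (PATerm.mul t u)) (t : PATerm) : C t := by
  induction t with
  | var x => exact var x
  | @func n f ts ih =>
    cases f with
    | zero => convert zero using 1; exact congrArg _ (List.ofFn_inj.1 rfl)
    | succ =>
      convert succ (ts 0) (ih 0) using 1
      exact congrArg _ (by ext i; fin_cases i; rfl)
    | add =>
      convert add (ts 0) (ts 1) (ih 0) (ih 1) using 1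
      exact congrArg _ (by ext i; fin_cases i <;> rfl)
    | mul =>
      convert mul (ts 0) (ts 1) (ih 0) (ih 1) using 1
      exact congrArg _ (by ext i; fin_cases i <;> rfl)

theorem form_induction {C : Form → Prop} (falsum : C .falsum)
    (equal : ∀ t u, C (.equal t u)) (imp : ∀ φ ψ, C φ → C ψ → C (.imp φ ψ))
    (all : ∀ x φ, C φ → C (.all x φ)) (know : ∀ φ, C φ → C (.know φ)) (φ : Form) : C φ := by
  induction φ with
  | falsum => exact falsum
  | equal t u => exact equal t u
  | rel R ts => exact Empty.elim R
  | imp φ ψ h1 h2 => exact imp φ ψ h1 h2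
  | all x φ h => exact all x φ h
  | know φ h => exact know φ h

@[simp] theorem codeTerm_v (x : ℕ) : codeTerm (PATerm.v x) = Nat.pair 0 x := by
  simp [PATerm.v, codeTerm]

@[simp] theorem codeTerm_zero : codeTerm PATerm.zero = Nat.pair 1 0 := by
  simp [PATerm.zero, codeTerm]

@[simp] theorem codeTerm_succ (t : PATerm) :
    codeTerm (PATerm.succ t) = Nat.pair 2 (codeTerm t) := by
  simp [PATerm.succ, codeTerm]

@[simp] theorem codeTerm_add (t u : PATerm) :
    codeTerm (PATerm.add t u) = Nat.pair 3 (Nat.pair (codeTerm t) (codeTerm u)) := by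
  simp [PATerm.add, codeTerm]

@[simp] theorem codeTerm_mul (t u : PATerm) :
    codeTerm (PATerm.mul t u) = Nat.pair 4 (Nat.pair (codeTerm t) (codeTerm u)) := by
  simp [PATerm.mul, codeTerm]

section SubstTerm

variable (σ : ℕ → PATerm)

@[simp] theorem subst_v (x : ℕ) : (PATerm.v x).subst σ = σ x := rfl

@[simp] theorem subst_zero : PATerm.zero.subst σ = PATerm.zero :=
  congrArg (FirstOrder.Language.Term.func (L := langPA) PAFunc.zero)
    (by ext i; exact i.elim0)

@[simp] theorem subst_succ (t : PATerm) : (PATerm.succ t).subst σ = PATerm.succ (t.subst σ) :=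
  congrArg (FirstOrder.Language.Term.func (L := langPA) PAFunc.succ)
    (by ext i; fin_cases i; rfl)

@[simp] theorem subst_add (t u : PATerm) :
    (PATerm.add t u).subst σ = PATerm.add (t.subst σ) (u.subst σ) :=
  congrArg (FirstOrder.Language.Term.func (L := langPA) PAFunc.add)
    (by ext i; fin_cases i <;> rfl)

@[simp] theorem subst_mul (t u : PATerm) :
    (PATerm.mul t u).subst σ = PATerm.mul (t.subst σ) (u.subst σ) :=
  congrArg (FirstOrder.Language.Term.func (L := langPA) PAFunc.mul)
    (by ext i; fin_cases i <;> rfl)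

end SubstTerm

section VarFinset

open FirstOrder.Language

@[simp] theorem mem_varFinset_v (x y : ℕ) : y ∈ (PATerm.v x).varFinset ↔ y = x := by
  simp [PATerm.v, Term.varFinset]

@[simp] theorem mem_varFinset_zero (y : ℕ) : y ∈ PATerm.zero.varFinset ↔ False := by
  simp [PATerm.zero, Term.varFinset]

@[simp] theorem mem_varFinset_succ (t : PATerm) (y : ℕ) :
    y ∈ (PATerm.succ t).varFinset ↔ y ∈ t.varFinset := by
  simp [PATerm.succ, Term.varFinset]

@[simp] theorem mem_varFinset_add (t u : PATerm) (y : ℕ) :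
    y ∈ (PATerm.add t u).varFinset ↔ y ∈ t.varFinset ∨ y ∈ u.varFinset := by
  simp [PATerm.add, Term.varFinset]

@[simp] theorem mem_varFinset_mul (t u : PATerm) (y : ℕ) :
    y ∈ (PATerm.mul t u).varFinset ↔ y ∈ t.varFinset ∨ y ∈ u.varFinset := by
  simp [PATerm.mul, Term.varFinset]

end VarFinset

/-! ### Syntactic operations on Gödel numbers -/

/-- The term with a given Gödel number; every number is read as some term. -/
def decTerm : ℕ → PATerm :=
  codeRec PATerm.v fun k _ t t₁ t₂ =>
    if k = 1 then PATerm.zero else if k = 2 then PATerm.succ t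
    else if k = 3 then PATerm.add t₁ t₂ else PATerm.mul t₁ t₂

/-- The formula with a given Gödel number; every number is read as some formula. -/
def decForm : ℕ → Form :=
  codeRec (fun _ => .falsum) fun k m φ φ₁ φ₂ =>
    if k = 1 then .equal (decTerm m.unpair.1) (decTerm m.unpair.2) else if k = 2 then .imp φ₁ φ₂
    else if k = 3 then .all m.unpair.1 φ₂ else .know φ

theorem decTerm_codeTerm (t : PATerm) : decTerm (codeTerm t) = t := by
  induction t using term_induction <;> simp_all [decTerm, codeRec_leaf, codeRec_node]

theorem decForm_code (φ : Form) : decForm (code φ) = φ := by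
  induction φ using form_induction <;>
    simp_all [decForm, code, codeRec_leaf, codeRec_node, decTerm_codeTerm]

/-- The number assigned to the variable `y` by the assignment with code `a`. The assignment `0`
sends each variable to its own Gödel number; `⟨x + 1, ⟨n, a⟩⟩` sends `x` to `n` and agrees with `a`
elsewhere. -/
def getVar (a y : ℕ) : ℕ :=
  codeRec (fun _ => Nat.pair 0 y) (fun k m _ _ r => if k = y + 1 then m.unpair.1 else r) a

/-- The code of the assignment `a` changed at `x` to `n`. -/
def updVar (a x n : ℕ) : ℕ := Nat.pair (x + 1) (Nat.pair n a)

@[simp] theorem getVar_leaf (m y : ℕ) : getVar (Nat.pair 0 m) y = Nat.pair 0 y := by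
  simp [getVar, codeRec_leaf]

@[simp] theorem getVar_zero (y : ℕ) : getVar 0 y = Nat.pair 0 y := getVar_leaf 0 y

theorem getVar_updVar (a x n : ℕ) : getVar (updVar a x n) = Function.update (getVar a) x n := by
  ext y
  rw [getVar, updVar, codeRec_node _ _ (by omega)]
  rcases eq_or_ne y x with rfl | h
  · simp
  · simp [h, h.symm, getVar]

/-- The result of the simultaneous substitution given by the assignment code `a` in the term
code `n`. -/
def substTerm (a n : ℕ) : ℕ :=
  codeRec (getVar a) (fun k _ r r₁ r₂ =>
    if k = 1 then Nat.pair 1 0 else if k = 2 then Nat.pair 2 r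
    else if k = 3 then Nat.pair 3 (Nat.pair r₁ r₂) else Nat.pair 4 (Nat.pair r₁ r₂)) n

theorem substTerm_codeTerm {a : ℕ} {σ : ℕ → PATerm} (h : ∀ y, getVar a y = codeTerm (σ y))
    (t : PATerm) : substTerm a (codeTerm t) = codeTerm (t.subst σ) := by
  induction t using term_induction <;> simp_all [substTerm, codeRec_leaf, codeRec_node]

/-- Substitution of the term code `t` for the variable `x` in the formula code `n`. -/
def substForm (x t n : ℕ) : ℕ :=
  codeRec (Nat.pair 0) (fun k m _ r₁ r₂ =>
    if k = 1 then Nat.pair 1 (Nat.pair (substTerm (updVar 0 x t) m.unpair.1)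
      (substTerm (updVar 0 x t) m.unpair.2))
    else if k = 2 then Nat.pair 2 (Nat.pair r₁ r₂)
    else if k = 3 then Nat.pair 3 (Nat.pair m.unpair.1 (if m.unpair.1 = x then m.unpair.2 else r₂))
    else Nat.pair k m) n

theorem substForm_code (x : ℕ) (t : PATerm) (φ : Form) :
    substForm x (codeTerm t) (code φ) = code (φ.subst x t) := by
  have key : ∀ u, substTerm (updVar 0 x (codeTerm t)) (codeTerm u) =
      codeTerm (u.subst (Function.update FirstOrder.Language.Term.var x t)) := by
    refine substTerm_codeTerm fun y => ?_
    rw [getVar_updVar]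
    rcases eq_or_ne y x with rfl | h
    · simp
    · rw [Function.update_of_ne h, Function.update_of_ne h, getVar_zero]
      exact (codeTerm_v y).symm
  induction φ using form_induction <;>
    simp_all [substForm, code, KFormula.subst, codeRec_leaf, codeRec_node, apply_ite code]

/-- Whether a number is the Gödel number of a term. -/
def isTerm : ℕ → Bool :=
  codeRec (fun _ => true) fun k m r r₁ r₂ =>
    if k = 1 then decide (m = 0) else if k = 2 then r else if k = 3 then r₁ && r₂
    else if k = 4 then r₁ && r₂ else false

/-- Whether a number is the Gödel number of a formula; for `b = false`, of a formula in which no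
symbol `K_φ` occurs. -/
def isForm (b : Bool) : ℕ → Bool :=
  codeRec (fun m => decide (m = 0)) fun k m r r₁ r₂ =>
    if k = 1 then isTerm m.unpair.1 && isTerm m.unpair.2 else if k = 2 then r₁ && r₂
    else if k = 3 then r₂ else if k = 4 then b && r else false

theorem isTerm_iff (n : ℕ) : isTerm n = true ↔ ∃ t, codeTerm t = n := by
  constructor
  · intro h
    suffices codeTerm (decTerm n) = n from ⟨_, this⟩
    induction n using code_induction with
    | leaf m => simp [decTerm, codeRec_leaf]
    | node k m hk h0 h1 h2 =>
      unfold isTerm decTerm at *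
      rw [codeRec_node _ _ hk] at h ⊢
      split_ifs at h ⊢ <;> simp_all
  · rintro ⟨t, rfl⟩
    induction t using term_induction <;> simp_all [isTerm, codeRec_leaf, codeRec_node]

theorem isForm_iff (b : Bool) (n : ℕ) :
    isForm b n = true ↔ ∃ φ : Form, (b = true ∨ φ.KFree) ∧ code φ = n := by
  constructor
  · intro h
    suffices (b = true ∨ (decForm n).KFree) ∧ code (decForm n) = n from ⟨_, this⟩
    induction n using code_induction with
    | leaf m => simp_all [decForm, isForm, codeRec_leaf, KFormula.KFree, code]
    | node k m hk h0 h1 h2 =>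
      unfold isForm decForm at *
      rw [codeRec_node _ _ hk] at h ⊢
      have ht : ∀ i, isTerm i = true → codeTerm (decTerm i) = i := by
        intro i hi
        obtain ⟨t, rfl⟩ := (isTerm_iff i).1 hi
        rw [decTerm_codeTerm]
      split_ifs at h ⊢ <;> cases b <;> simp_all [code, KFormula.KFree]
  · rintro ⟨φ, hφ, rfl⟩
    have ht : ∀ t, isTerm (codeTerm t) = true := fun t => (isTerm_iff _).2 ⟨t, rfl⟩
    induction φ using form_induction <;>
      simp_all [isForm, code, KFormula.KFree, codeRec_leaf, codeRec_node]
    all_goals tauto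

/-- Whether the variable `y` occurs in the term code `n`. -/
def occTerm (y : ℕ) : ℕ → Bool :=
  codeRec (fun m => decide (y = m)) fun k _ r r₁ r₂ =>
    if k = 1 then false else if k = 2 then r else r₁ || r₂

/-- Whether the variable `y` occurs free in the formula code `n`. -/
def occForm (y : ℕ) : ℕ → Bool :=
  codeRec (fun _ => false) fun k m _ r₁ r₂ =>
    if k = 1 then occTerm y m.unpair.1 || occTerm y m.unpair.2 else if k = 2 then r₁ || r₂
    else if k = 3 then !decide (y = m.unpair.1) && r₂ else false

theorem occTerm_codeTerm (y : ℕ) (t : PATerm) :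
    occTerm y (codeTerm t) = true ↔ y ∈ t.varFinset := by
  induction t using term_induction <;> simp_all [occTerm, codeRec_leaf, codeRec_node]

theorem occForm_code (y : ℕ) (φ : Form) : occForm y (code φ) = true ↔ y ∈ φ.freeVars := by
  induction φ using form_induction <;>
    simp_all [occForm, code, KFormula.freeVars, codeRec_leaf, codeRec_node, occTerm_codeTerm]

theorem le_of_occTerm {y n : ℕ} (h : occTerm y n = true) : y ≤ n := by
  induction n using code_induction with
  | leaf m =>
    simp only [occTerm, codeRec_leaf, decide_eq_true_eq] at h
    exact h ▸ le_pair_right _ _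
  | node k m hk h0 h1 h2 =>
    unfold occTerm at *
    rw [codeRec_node _ _ hk] at h
    have := le_pair_right k m
    have := Nat.unpair_left_le m
    have := Nat.unpair_right_le m
    split_ifs at h
    · grind
    · grind

theorem le_of_occForm {y n : ℕ} (h : occForm y n = true) : y ≤ n := by
  induction n using code_induction with
  | leaf m => simp [occForm, codeRec_leaf] at h
  | node k m hk h0 h1 h2 =>
    unfold occForm at *
    rw [codeRec_node _ _ hk] at h
    have := le_pair_right k m
    have := Nat.unpair_left_le m
    have := Nat.unpair_right_le m
    split_ifs at h
    · rcases (Bool.or_eq_true_iff).1 h with h | h <;> have := le_of_occTerm h <;> omega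
    · grind
    · grind

/-- The list of numbers with a given code; every number codes a list. -/
def decList : ℕ → List ℕ :=
  codeRec (fun _ => []) fun k _ r _ _ => (k - 1) :: r

theorem decList_surjective (xs : List ℕ) : ∃ l, decList l = xs := by
  induction xs with
  | nil => exact ⟨Nat.pair 0 0, by rw [decList, codeRec_leaf]⟩
  | cons x xs ih =>
    obtain ⟨l, hl⟩ := ih
    exact ⟨Nat.pair (x + 1) l, by rw [decList, codeRec_node _ _ (by omega), ← decList, hl]; simp⟩

/-- Membership in the list coded by `l`. -/
def memList (y : ℕ) : ℕ → Bool :=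
  codeRec (fun _ => false) fun k _ r _ _ => decide (y = k - 1) || r

/-- Prefixing the formula code `n` with universal quantifiers over the list coded by `l`. -/
def closeForm (n : ℕ) : ℕ → ℕ :=
  codeRec (fun _ => n) fun k _ r _ _ => Nat.pair 3 (Nat.pair (k - 1) r)

theorem memList_iff (y l : ℕ) : memList y l = true ↔ y ∈ decList l := by
  induction l using code_induction with
  | leaf m => simp [memList, decList, codeRec_leaf]
  | node k m hk h0 h1 h2 =>
    unfold memList decList at *
    rw [codeRec_node _ _ hk, codeRec_node _ _ hk]
    simp [h0]

theorem closeForm_code (φ : Form) (l : ℕ) :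
    closeForm (code φ) l = code (KFormula.allList (decList l) φ) := by
  induction l using code_induction with
  | leaf m => simp [closeForm, decList, codeRec_leaf, KFormula.allList]
  | node k m hk h0 h1 h2 =>
    unfold closeForm decList at *
    rw [codeRec_node _ _ hk, codeRec_node _ _ hk]
    simp only [KFormula.allList, List.foldr_cons, code] at h0 ⊢
    rw [h0]

section Primrec

variable {α : Type*} [Primcodable α]

@[fun_prop]
theorem primrec_getVar {f g : α → ℕ} (hf : Primrec f) (hg : Primrec g) :
    Primrec fun a => getVar (f a) (g a) :=
  primrec_codeRec (B := fun a _ => Nat.pair 0 (g a))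
    (G := fun a k m _ _ r => if k = g a + 1 then m.unpair.1 else r)
    (by fun_prop) (by fun_prop) hf

@[fun_prop]
theorem primrec_updVar {f g h : α → ℕ} (hf : Primrec f) (hg : Primrec g) (hh : Primrec h) :
    Primrec fun a => updVar (f a) (g a) (h a) := by
  unfold updVar; fun_prop

@[fun_prop]
theorem primrec_substTerm {f g : α → ℕ} (hf : Primrec f) (hg : Primrec g) :
    Primrec fun a => substTerm (f a) (g a) :=
  primrec_codeRec (B := fun a m => getVar (f a) m)
    (G := fun _ k _ r r₁ r₂ =>
      if k = 1 then Nat.pair 1 0 else if k = 2 then Nat.pair 2 r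
      else if k = 3 then Nat.pair 3 (Nat.pair r₁ r₂) else Nat.pair 4 (Nat.pair r₁ r₂))
    (by fun_prop) (by fun_prop) hg

@[fun_prop]
theorem primrec_substForm {f g h : α → ℕ} (hf : Primrec f) (hg : Primrec g) (hh : Primrec h) :
    Primrec fun a => substForm (f a) (g a) (h a) :=
  primrec_codeRec (B := fun _ m => Nat.pair 0 m)
    (G := fun a k m _ r₁ r₂ =>
      if k = 1 then Nat.pair 1 (Nat.pair (substTerm (updVar 0 (f a) (g a)) m.unpair.1)
        (substTerm (updVar 0 (f a) (g a)) m.unpair.2))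
      else if k = 2 then Nat.pair 2 (Nat.pair r₁ r₂)
      else if k = 3 then
        Nat.pair 3 (Nat.pair m.unpair.1 (if m.unpair.1 = f a then m.unpair.2 else r₂))
      else Nat.pair k m)
    (by fun_prop) (by fun_prop) hh

@[fun_prop]
theorem primrec_isTerm {f : α → ℕ} (hf : Primrec f) : Primrec fun a => isTerm (f a) :=
  primrec_codeRec (B := fun _ _ => true)
    (G := fun _ k m r r₁ r₂ =>
      if k = 1 then decide (m = 0) else if k = 2 then r else if k = 3 then r₁ && r₂
      else if k = 4 then r₁ && r₂ else false)
    (by fun_prop) (by fun_prop) hf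

@[fun_prop]
theorem primrec_isForm (b : Bool) {f : α → ℕ} (hf : Primrec f) :
    Primrec fun a => isForm b (f a) :=
  primrec_codeRec (B := fun _ m => decide (m = 0))
    (G := fun _ k m r r₁ r₂ =>
      if k = 1 then isTerm m.unpair.1 && isTerm m.unpair.2 else if k = 2 then r₁ && r₂
      else if k = 3 then r₂ else if k = 4 then b && r else false)
    (by fun_prop) (by fun_prop) hf

@[fun_prop]
theorem primrec_occTerm {f g : α → ℕ} (hf : Primrec f) (hg : Primrec g) :
    Primrec fun a => occTerm (f a) (g a) :=
  primrec_codeRec (B := fun a m => decide (f a = m))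
    (G := fun _ k _ r r₁ r₂ => if k = 1 then false else if k = 2 then r else r₁ || r₂)
    (by fun_prop) (by fun_prop) hg

@[fun_prop]
theorem primrec_occForm {f g : α → ℕ} (hf : Primrec f) (hg : Primrec g) :
    Primrec fun a => occForm (f a) (g a) :=
  primrec_codeRec (B := fun _ _ => false)
    (G := fun a k m _ r₁ r₂ =>
      if k = 1 then occTerm (f a) m.unpair.1 || occTerm (f a) m.unpair.2
      else if k = 2 then r₁ || r₂
      else if k = 3 then !decide (f a = m.unpair.1) && r₂ else false)
    (by fun_prop) (by fun_prop) hg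

@[fun_prop]
theorem primrec_memList {f g : α → ℕ} (hf : Primrec f) (hg : Primrec g) :
    Primrec fun a => memList (f a) (g a) :=
  primrec_codeRec (B := fun _ _ => false)
    (G := fun a k _ r _ _ => decide (f a = k - 1) || r) (by fun_prop) (by fun_prop) hg

@[fun_prop]
theorem primrec_closeForm {f g : α → ℕ} (hf : Primrec f) (hg : Primrec g) :
    Primrec fun a => closeForm (f a) (g a) :=
  primrec_codeRec (B := fun a _ => f a)
    (G := fun _ k _ r _ _ => Nat.pair 3 (Nat.pair (k - 1) r)) (by fun_prop) (by fun_prop) hg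

end Primrec

/-! ### Unsatisfiability of a computable sequence of clauses -/

/-- The valuation `v` satisfies every clause of the list `C`; a clause is a list of literals
`(i, b)`, one of which must satisfy `v i = b`. -/
def ClausesSat (v : ℕ → Bool) (C : List (List (ℕ × Bool))) : Prop :=
  ∀ cl ∈ C, ∃ l ∈ cl, v l.1 = l.2

theorem isClosed_clausesSat (C : List (List (ℕ × Bool))) : IsClosed {v | ClausesSat v C} := by
  have : {v | ClausesSat v C} = ⋂ cl ∈ C, ⋃ l ∈ cl, {v : ℕ → Bool | v l.1 = l.2} := by
    ext v; simp [ClausesSat]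
  rw [this]
  refine isClosed_biInter fun cl _ => (List.finite_toSet cl).isClosed_biUnion fun l _ => ?_
  exact isClosed_eq (continuous_apply l.1) continuous_const

/-- Compactness of the Cantor space: an unsatisfiable sequence of clauses is refuted, for some `N`,
by its first `N` members and the atoms below `N`. The numbers `w < 2 ^ N` run through the
valuations of these atoms. -/
theorem unsat_iff (c : ℕ → List (List (ℕ × Bool))) :
    (¬∃ v, ∀ i, ClausesSat v (c i)) ↔
      ∃ N, ∀ w < 2 ^ N, ∃ i < N, ∃ cl ∈ c i, ∀ l ∈ cl, l.1 < N ∧ Nat.testBit w l.1 ≠ l.2 := by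
  constructor
  · intro h
    have hempty : (Set.univ ∩ ⋂ i, {v | ClausesSat v (c i)}) = ∅ := by
      ext v
      simpa using fun hv => h ⟨v, hv⟩
    obtain ⟨t, ht⟩ := isCompact_univ.elim_finite_subfamily_closed
      (fun i => {v | ClausesSat v (c i)}) (fun i => isClosed_clausesSat (c i)) hempty
    obtain ⟨N₁, hN₁⟩ : ∃ N, ∀ i ∈ t, i < N :=
      ⟨t.sup id + 1, fun i hi => Nat.lt_succ_of_le (Finset.le_sup (f := id) hi)⟩
    obtain ⟨N₂, hN₂⟩ : ∃ N, ∀ i ∈ t, ∀ cl ∈ c i, ∀ l ∈ cl, l.1 < N := by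
      have hfin : (⋃ i ∈ t, ⋃ cl ∈ c i, ⋃ l ∈ cl, {l.1}).Finite :=
        t.finite_toSet.biUnion fun i _ => (List.finite_toSet (c i)).biUnion fun cl _ =>
          (List.finite_toSet cl).biUnion fun l _ => Set.finite_singleton _
      obtain ⟨N, hN⟩ := hfin.bddAbove
      refine ⟨N + 1, fun i hi cl hcl l hl => Nat.lt_succ_of_le (hN ?_)⟩
      simp only [Set.mem_iUnion]
      exact ⟨i, hi, cl, hcl, l, hl, rfl⟩
    refine ⟨max N₁ N₂, fun w _ => ?_⟩
    have hw : ¬∀ i ∈ t, ClausesSat (Nat.testBit w) (c i) := by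
      intro hw
      have : Nat.testBit w ∈ (Set.univ ∩ ⋂ i ∈ t, {v | ClausesSat v (c i)}) := by simpa using hw
      rw [ht] at this
      exact this
    simp only [ClausesSat] at hw
    push Not at hw
    obtain ⟨i, hi, cl, hcl, hl⟩ := hw
    exact ⟨i, lt_max_of_lt_left (hN₁ i hi), cl, hcl, fun l h =>
      ⟨lt_max_of_lt_right (hN₂ i hi cl hcl l h), hl l h⟩⟩
  · rintro ⟨N, hN⟩ ⟨v, hv⟩
    -- The restriction of `v` to the atoms below `N`, as a number.
    obtain ⟨i, _, cl, hcl, hl⟩ := hN (Nat.ofBits fun i : Fin N => v i) (Nat.ofBits_lt_two_pow _)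
    obtain ⟨l, hmem, hvl⟩ := hv i cl hcl
    obtain ⟨hlt, hne⟩ := hl l hmem
    rw [Nat.testBit_ofBits_lt _ _ hlt] at hne
    exact hne hvl

theorem primrec_testBit : Primrec₂ Nat.testBit := by
  have hpow : Primrec₂ fun a b : ℕ => a ^ b := Primrec₂.unpaired'.1 Nat.Primrec.pow
  have h : Primrec fun p : ℕ × ℕ => decide (p.1 / 2 ^ p.2 % 2 = 1) :=
    primrec_decide_eq (Primrec.nat_mod.comp
      (Primrec.nat_div.comp Primrec.fst (hpow.comp (Primrec.const 2) Primrec.snd))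
      (Primrec.const 2)) (Primrec.const 1)
  exact h.of_eq fun p => (Nat.testBit_eq_decide_div_mod_eq).symm

theorem primrecRel_exists_lt {β : Type*} [Primcodable β] {R : ℕ → β → Prop} (h : PrimrecRel R) :
    PrimrecRel fun n b => ∃ x < n, R x b :=
  (h.exists_mem_list.comp (Primrec.list_range.comp Primrec.fst) Primrec.snd).of_eq (by simp)

theorem primrecRel_forall_lt {β : Type*} [Primcodable β] {R : ℕ → β → Prop} (h : PrimrecRel R) :
    PrimrecRel fun n b => ∀ x < n, R x b :=
  (h.forall_mem_list.comp (Primrec.list_range.comp Primrec.fst) Primrec.snd).of_eq (by simp)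

/-- By `unsat_iff`, unsatisfiability is witnessed by a number `N` with a primitive recursive
property. -/
theorem sigmaOne_unsat {c : ℕ → ℕ → List (List (ℕ × Bool))}
    (hc : Primrec fun p : ℕ × ℕ => c p.1 p.2) :
    SigmaOne fun n => ¬∃ v, ∀ i, ClausesSat v (c n i) := by
  classical
  have h1 : PrimrecRel fun (l : ℕ × Bool) (q : ℕ × ℕ) =>
      l.1 < q.2 ∧ Nat.testBit q.1 l.1 ≠ l.2 := by
    refine PrimrecPred.and (PrimrecRel.comp Primrec.nat_lt (by fun_prop) (by fun_prop))
      (PrimrecPred.not (PrimrecRel.comp Primrec.eq ?_ (by fun_prop)))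
    exact primrec_testBit.comp (g := fun p : (ℕ × Bool) × (ℕ × ℕ) => p.2.1)
      (h := fun p => p.1.1) (by fun_prop) (by fun_prop)
  have h2 := h1.forall_mem_list.exists_mem_list
  have h3 : PrimrecRel fun (i : ℕ) (q : ℕ × ℕ × ℕ) => ∃ cl ∈ c q.2.2 i, ∀ l ∈ cl,
      l.1 < q.2.1 ∧ Nat.testBit q.1 l.1 ≠ l.2 :=
    h2.comp (f := fun p : ℕ × ℕ × ℕ × ℕ => c p.2.2.2 p.1)
      (g := fun p : ℕ × ℕ × ℕ × ℕ => (p.2.1, p.2.2.1))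
      (hc.comp (g := fun p : ℕ × ℕ × ℕ × ℕ => (p.2.2.2, p.1)) (by fun_prop)) (by fun_prop)
  have h3' := primrecRel_exists_lt h3
  have h4 : PrimrecRel fun (w : ℕ) (q : ℕ × ℕ) => ∃ i < q.1, ∃ cl ∈ c q.2 i, ∀ l ∈ cl,
      l.1 < q.1 ∧ Nat.testBit w l.1 ≠ l.2 :=
    h3'.comp (f := fun p : ℕ × ℕ × ℕ => p.2.1)
      (g := fun p : ℕ × ℕ × ℕ => (p.1, p.2.1, p.2.2)) (by fun_prop) (by fun_prop)
  have h4' := primrecRel_forall_lt h4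
  have h5 : PrimrecPred fun q : ℕ × ℕ => ∀ w < 2 ^ q.2, ∃ i < q.2, ∃ cl ∈ c q.1 i, ∀ l ∈ cl,
      l.1 < q.2 ∧ Nat.testBit w l.1 ≠ l.2 :=
    h4'.comp (f := fun p : ℕ × ℕ => 2 ^ p.2) (g := fun p : ℕ × ℕ => (p.2, p.1))
      ((Primrec₂.unpaired'.1 Nat.Primrec.pow).comp (Primrec.const 2) Primrec.snd) (by fun_prop)
  exact ⟨fun n N => decide (∀ w < 2 ^ N, ∃ i < N, ∃ cl ∈ c n i, ∀ l ∈ cl,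
      l.1 < N ∧ Nat.testBit w l.1 ≠ l.2), h5.decide, fun n => by
    simpa only [decide_eq_true_eq] using unsat_iff (c n)⟩

/-! ### Truth valuations -/

/-- The index of the statement that the names `n` and `m` denote the same element: the formula
`x₀ = x₁` under the assignment of `n` to `x₀` and of `m` to `x₁`. -/
def eqIndex (n m : ℕ) : ℕ :=
  Nat.pair (Nat.pair 1 (Nat.pair (Nat.pair 0 0) (Nat.pair 0 1))) (updVar (updVar 0 0 n) 1 m)

/-- The witness constant for `∀ x p` under the assignment `a`: the name of an element at which `p`
fails, if there is one. The tags `0, …, 4` of names are those of terms. -/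
def witness (x p a : ℕ) : ℕ := Nat.pair (5 + x) (Nat.pair p a)

/-- `v` is the truth valuation of a model that consists of named elements: `v ⟨p, a⟩` is the truth
value of the formula coded by `p` under the assignment of names coded by `a`. A name is a term code,
possibly containing witness constants. The formulas `p` with `∃ m, R p m` are required to be true
under every assignment, and the formula coded by `n` to be false under the assignment `0`. -/
structure IsTruth (R : ℕ → ℕ → Bool) (n : ℕ) (v : ℕ → Bool) : Prop where
  falsum : ∀ p a, v (Nat.pair (Nat.pair 0 p) a) = false
  equal : ∀ p q a, v (Nat.pair (Nat.pair 1 (Nat.pair p q)) a) =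
    v (eqIndex (substTerm a p) (substTerm a q))
  imp : ∀ p q a, v (Nat.pair (Nat.pair 2 (Nat.pair p q)) a) =
    (!v (Nat.pair p a) || v (Nat.pair q a))
  inst : ∀ x p a m, v (Nat.pair (Nat.pair 3 (Nat.pair x p)) a) = true →
    v (Nat.pair p (updVar a x m)) = true
  wit : ∀ x p a, v (Nat.pair p (updVar a x (witness x p a))) = true →
    v (Nat.pair (Nat.pair 3 (Nat.pair x p)) a) = true
  know : ∀ p a b, v (Nat.pair (Nat.pair 4 p) a) = true → v (Nat.pair (Nat.pair 4 p) b) = true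
  refl : ∀ i, v (eqIndex i i) = true
  eucl : ∀ i j k, v (eqIndex i j) = true → v (eqIndex i k) = true → v (eqIndex j k) = true
  succ : ∀ i j, v (eqIndex i j) = true → v (eqIndex (Nat.pair 2 i) (Nat.pair 2 j)) = true
  add : ∀ i i' j j', v (eqIndex i i') = true → v (eqIndex j j') = true →
    v (eqIndex (Nat.pair 3 (Nat.pair i j)) (Nat.pair 3 (Nat.pair i' j'))) = true
  mul : ∀ i i' j j', v (eqIndex i i') = true → v (eqIndex j j') = true →
    v (eqIndex (Nat.pair 4 (Nat.pair i j)) (Nat.pair 4 (Nat.pair i' j'))) = true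
  ax : ∀ p m a, R p m = true → v (Nat.pair p a) = true
  target : v (Nat.pair n 0) = false

/-- The clauses that express `IsTruth`, with `p`, `q`, `r`, `a` instantiating the universally
quantified numbers. -/
def truthClauses (R : ℕ → ℕ → Bool) (n p q r a : ℕ) : List (List (ℕ × Bool)) :=
  [[(Nat.pair (Nat.pair 0 p) a, false)],
   [(Nat.pair (Nat.pair 1 (Nat.pair p q)) a, false),
    (eqIndex (substTerm a p) (substTerm a q), true)],
   [(Nat.pair (Nat.pair 1 (Nat.pair p q)) a, true),
    (eqIndex (substTerm a p) (substTerm a q), false)],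
   [(Nat.pair (Nat.pair 2 (Nat.pair p q)) a, false), (Nat.pair p a, false), (Nat.pair q a, true)],
   [(Nat.pair (Nat.pair 2 (Nat.pair p q)) a, true), (Nat.pair p a, true)],
   [(Nat.pair (Nat.pair 2 (Nat.pair p q)) a, true), (Nat.pair q a, false)],
   [(Nat.pair (Nat.pair 3 (Nat.pair p q)) a, false), (Nat.pair q (updVar a p r), true)],
   [(Nat.pair (Nat.pair 3 (Nat.pair p q)) a, true),
    (Nat.pair q (updVar a p (witness p q a)), false)],
   [(Nat.pair (Nat.pair 4 p) a, false), (Nat.pair (Nat.pair 4 p) r, true)],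
   [(eqIndex p p, true)],
   [(eqIndex p q, false), (eqIndex p r, false), (eqIndex q r, true)],
   [(eqIndex p q, false), (eqIndex (Nat.pair 2 p) (Nat.pair 2 q), true)],
   [(eqIndex p q, false), (eqIndex r a, false),
    (eqIndex (Nat.pair 3 (Nat.pair p r)) (Nat.pair 3 (Nat.pair q a)), true)],
   [(eqIndex p q, false), (eqIndex r a, false),
    (eqIndex (Nat.pair 4 (Nat.pair p r)) (Nat.pair 4 (Nat.pair q a)), true)],
   -- This clause is a tautology if `R p r = false`.
   [(Nat.pair p a, true), (Nat.pair p a, R p r)],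
   [(Nat.pair n 0, false)]]

theorem isTruth_iff (R : ℕ → ℕ → Bool) (n : ℕ) (v : ℕ → Bool) :
    IsTruth R n v ↔ ∀ p q r a, ClausesSat v (truthClauses R n p q r a) := by
  simp only [ClausesSat, truthClauses, List.forall_mem_cons, List.exists_mem_cons_iff,
    List.not_mem_nil, false_and, exists_false, or_false, false_imp_iff, implies_true, and_true]
  constructor
  · rintro ⟨h1, h2, h3, h4, h5, h6, h7, h8, h9, h10, h11, h12, h13⟩ p q r a
    have e2 := h2 p q a
    have e3 := h3 p q a
    have e4 := h4 p q a r
    have e5 := h5 p q a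
    have e6 := h6 p a r
    have e8 := h8 p q r
    have e9 := h9 p q
    have e10 := h10 p q r a
    have e11 := h11 p q r a
    have e12 := h12 p r a
    refine ⟨h1 p a, ?_, ?_, ?_, ?_, ?_, ?_, ?_, ?_, h7 p, ?_, ?_, ?_, ?_, ?_, h13⟩ <;> grind
  · intro h
    constructor <;> intros
    · rename_i p a; exact (h p 0 0 a).1
    · rename_i p q a; have := h p q 0 a; grind
    · rename_i p q a; have := h p q 0 a; grind
    · rename_i x p a m _; have := h x p m a; grind
    · rename_i x p a _; have := h x p 0 a; grind
    · rename_i p a b _; have := h p 0 b a; grind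
    · rename_i i; have := h i 0 0 0; grind
    · rename_i i j k _ _; have := h i j k 0; grind
    · rename_i i j _; have := h i j 0 0; grind
    · rename_i i i' j j' _ _; have := h i i' j j'; grind
    · rename_i i i' j j' _ _; have := h i i' j j'; grind
    · rename_i p m a _; have := h p 0 m a; grind
    · have := h 0 0 0 0; grind

theorem sigmaOne_not_exists_isTruth {R : ℕ → ℕ → Bool} (hR : Primrec fun p : ℕ × ℕ => R p.1 p.2) :
    SigmaOne fun n => ¬∃ v, IsTruth R n v := by
  have hR' : ∀ {f g : ℕ × ℕ → ℕ}, Primrec f → Primrec g → Primrec fun p => R (f p) (g p) :=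
    fun hf hg => hR.comp (hf.pair hg)
  have hc : Primrec fun p : ℕ × ℕ => truthClauses R p.1 p.2.unpair.1 p.2.unpair.2.unpair.1
      p.2.unpair.2.unpair.2.unpair.1 p.2.unpair.2.unpair.2.unpair.2 := by
    unfold truthClauses eqIndex witness
    fun_prop
  refine (sigmaOne_unsat (c := fun n i => truthClauses R n i.unpair.1 i.unpair.2.unpair.1
      i.unpair.2.unpair.2.unpair.1 i.unpair.2.unpair.2.unpair.2) hc).of_eq fun n => ?_
  refine not_congr (exists_congr fun v => (isTruth_iff R n v).trans ⟨fun h i => h _ _ _ _, ?_⟩)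
  intro h p q r a
  simpa using h (Nat.pair p (Nat.pair q (Nat.pair r a)))

/-! ### From models to truth valuations -/

section Realize

open FirstOrder.Language

variable {M : Type} [langPA.Structure M] (s : ℕ → M)

theorem realize_v (x : ℕ) : (PATerm.v x).realize s = s x := rfl

theorem realize_zero : PATerm.zero.realize s =
    Structure.funMap (L := langPA) (M := M) PAFunc.zero ![] :=
  congrArg (Structure.funMap (L := langPA) (M := M) PAFunc.zero) (by ext i; exact i.elim0)

theorem realize_succ (t : PATerm) : (PATerm.succ t).realize s =
    Structure.funMap (L := langPA) (M := M) PAFunc.succ ![t.realize s] :=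
  congrArg (Structure.funMap (L := langPA) (M := M) PAFunc.succ) (by ext i; fin_cases i; rfl)

theorem realize_add (t u : PATerm) : (PATerm.add t u).realize s =
    Structure.funMap (L := langPA) (M := M) PAFunc.add ![t.realize s, u.realize s] :=
  congrArg (Structure.funMap (L := langPA) (M := M) PAFunc.add) (by ext i; fin_cases i <;> rfl)

theorem realize_mul (t u : PATerm) : (PATerm.mul t u).realize s =
    Structure.funMap (L := langPA) (M := M) PAFunc.mul ![t.realize s, u.realize s] :=
  congrArg (Structure.funMap (L := langPA) (M := M) PAFunc.mul) (by ext i; fin_cases i <;> rfl)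

end Realize

/-- The names used by an assignment are at most its code, except for the variables that it leaves
unchanged. -/
theorem getVar_le (a y : ℕ) : getVar a y ≤ a ∨ getVar a y = Nat.pair 0 y := by
  induction a using code_induction with
  | leaf m => exact Or.inr (getVar_leaf m y)
  | node k m hk h0 h1 h2 =>
    unfold getVar at *
    rw [codeRec_node _ _ hk]
    have := le_pair_right k m
    have := Nat.unpair_left_le m
    have := Nat.unpair_right_le m
    split_ifs
    · omega
    · rcases h2 with h2 | h2
      · omega
      · exact Or.inr h2

section ElemOf

open FirstOrder.Language

variable (M : KStructure langPA)

open Classical in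
/-- A counterexample to `∀ x φ` under the assignment `ρ`, if there is one. -/
noncomputable def counterexample (ρ : ℕ → M.carrier) (x : ℕ) (φ : Form) : M.carrier :=
  if h : ∃ d, ¬M.Sat (Function.update ρ x d) φ then h.choose else Classical.choice M.nonempty

theorem sat_all_of_counterexample {ρ : ℕ → M.carrier} {x : ℕ} {φ : Form}
    (h : M.Sat (Function.update ρ x (counterexample M ρ x φ)) φ) : M.Sat ρ (.all x φ) := by
  by_contra hn
  have hex : ∃ d, ¬M.Sat (Function.update ρ x d) φ := by
    simpa [KStructure.Sat] using hn
  rw [counterexample, dif_pos hex] at h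
  exact hex.choose_spec h

/-- The element of `M` denoted by a name. The variable `x` denotes `s x`, and a witness constant
denotes a counterexample for its formula. This is a recursion because a name used by an assignment
is at most the code of the assignment (`getVar_le`), unless it belongs to a variable left
unchanged. -/
noncomputable def elemOf (s : ℕ → M.carrier) (n : ℕ) : M.carrier :=
  if _h : n.unpair.1 = 0 then s n.unpair.2
  else if n.unpair.1 = 1 then Structure.funMap (L := langPA) PAFunc.zero ![]
  else if n.unpair.1 = 2 then
    Structure.funMap (L := langPA) PAFunc.succ ![elemOf s n.unpair.2]
  else if n.unpair.1 = 3 then Structure.funMap (L := langPA) PAFunc.add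
    ![elemOf s n.unpair.2.unpair.1, elemOf s n.unpair.2.unpair.2]
  else if n.unpair.1 = 4 then Structure.funMap (L := langPA) PAFunc.mul
    ![elemOf s n.unpair.2.unpair.1, elemOf s n.unpair.2.unpair.2]
  else counterexample M (fun y =>
    if _h' : getVar n.unpair.2.unpair.2 y < n then elemOf s (getVar n.unpair.2.unpair.2 y) else s y)
    (n.unpair.1 - 5) (decForm n.unpair.2.unpair.1)
termination_by n
decreasing_by
  all_goals first
    | assumption
    | exact unpair_snd_lt ‹_›
    | exact (Nat.unpair_left_le _).trans_lt (unpair_snd_lt ‹_›)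
    | exact (Nat.unpair_right_le _).trans_lt (unpair_snd_lt ‹_›)

variable {M} (s : ℕ → M.carrier)

theorem elemOf_leaf (m : ℕ) : elemOf M s (Nat.pair 0 m) = s m := by
  rw [elemOf]; simp

theorem elemOf_zero (m : ℕ) : elemOf M s (Nat.pair 1 m) =
    Structure.funMap (L := langPA) PAFunc.zero ![] := by
  rw [elemOf]; simp

theorem elemOf_succ (m : ℕ) : elemOf M s (Nat.pair 2 m) =
    Structure.funMap (L := langPA) PAFunc.succ ![elemOf M s m] := by
  rw [elemOf]; simp

theorem elemOf_add (i j : ℕ) : elemOf M s (Nat.pair 3 (Nat.pair i j)) =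
    Structure.funMap (L := langPA) PAFunc.add ![elemOf M s i, elemOf M s j] := by
  rw [elemOf]; simp

theorem elemOf_mul (i j : ℕ) : elemOf M s (Nat.pair 4 (Nat.pair i j)) =
    Structure.funMap (L := langPA) PAFunc.mul ![elemOf M s i, elemOf M s j] := by
  rw [elemOf]; simp

/-- The assignment of elements of `M` given by an assignment of names. -/
noncomputable def assign (M : KStructure langPA) (s : ℕ → M.carrier) (a : ℕ) : ℕ → M.carrier :=
  fun y => elemOf M s (getVar a y)

theorem assign_zero : assign M s 0 = s := by
  ext y; simp [assign, elemOf_leaf]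

theorem assign_updVar (a x n : ℕ) :
    assign M s (updVar a x n) = Function.update (assign M s a) x (elemOf M s n) := by
  ext y
  simp only [assign, getVar_updVar, Function.update_apply]
  split_ifs <;> rfl

theorem elemOf_witness (x p a : ℕ) :
    elemOf M s (witness x p a) = counterexample M (assign M s a) x (decForm p) := by
  rw [elemOf, witness]
  simp only [Nat.unpair_pair]
  rw [dif_neg (by omega), if_neg (by omega), if_neg (by omega), if_neg (by omega),
    if_neg (by omega), Nat.add_sub_cancel_left]
  congr 1
  ext y
  split_ifs with h
  · rfl
  · have h1 := le_pair_right p a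
    have h2 := Nat.add_le_pair (5 + x) (Nat.pair p a)
    have h3 := (getVar_le a y).resolve_left (by omega)
    rw [assign, h3, elemOf_leaf]

/-- Substituting names for the variables of a term gives a name of its value. -/
theorem elemOf_substTerm (a n : ℕ) :
    elemOf M s (substTerm a n) = (decTerm n).realize (assign M s a) := by
  induction n using code_induction with
  | leaf m => simp [substTerm, decTerm, codeRec_leaf, realize_v, assign]
  | node k m hk h0 h1 h2 =>
    unfold substTerm decTerm at *
    rw [codeRec_node _ _ hk, codeRec_node _ _ hk]
    split_ifs
    · rw [elemOf_zero, realize_zero]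
    · rw [elemOf_succ, realize_succ, h0]
    · rw [elemOf_add, realize_add, h1, h2]
    · rw [elemOf_mul, realize_mul, h1, h2]

open Classical in
/-- The truth valuation of the part of `M` that consists of the named elements, which is an
elementary substructure. -/
noncomputable def valuation (M : KStructure langPA) (s : ℕ → M.carrier) (i : ℕ) : Bool :=
  decide (M.Sat (assign M s i.unpair.2) (decForm i.unpair.1))

theorem valuation_pair (p a : ℕ) :
    valuation M s (Nat.pair p a) = true ↔ M.Sat (assign M s a) (decForm p) := by
  simp [valuation]

theorem valuation_eqIndex (i j : ℕ) :
    valuation M s (eqIndex i j) = true ↔ elemOf M s i = elemOf M s j := by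
  rw [eqIndex, valuation_pair]
  simp [decForm, decTerm, codeRec_leaf, codeRec_node, KStructure.Sat, realize_v, assign_updVar]

/-- A model of the formulas `p` with `∃ m, R p m`, with an assignment that falsifies `φ`, gives a
truth valuation. -/
theorem isTruth_valuation {R : ℕ → ℕ → Bool} {φ : Form}
    (hR : ∀ p m, R p m = true → M.Models (decForm p)) (hφ : ¬M.Sat s φ) :
    IsTruth R (code φ) (valuation M s) where
  falsum p a := by
    rw [← Bool.not_eq_true, valuation_pair]
    simp [decForm, codeRec_leaf, KStructure.Sat]
  equal p q a := by
    rw [Bool.eq_iff_iff, valuation_eqIndex, valuation_pair, elemOf_substTerm, elemOf_substTerm]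
    simp [decForm, codeRec_node, KStructure.Sat]
  imp p q a := by
    rw [Bool.eq_iff_iff, valuation_pair, Bool.or_eq_true, Bool.not_eq_true',
      ← Bool.not_eq_true, valuation_pair, valuation_pair, ← imp_iff_not_or]
    simp [decForm, codeRec_node, KStructure.Sat]
  inst x p a m := by
    rw [valuation_pair, valuation_pair, assign_updVar]
    simp only [decForm, ne_eq, OfNat.ofNat_ne_zero, not_false_eq_true, codeRec_node]
    simpa [KStructure.Sat] using fun h => h _
  wit x p a := by
    rw [valuation_pair, valuation_pair, assign_updVar, elemOf_witness]
    intro h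
    have := sat_all_of_counterexample M h
    simpa [decForm, codeRec_node] using this
  know p a b := by
    rw [valuation_pair, valuation_pair]
    simp [decForm, codeRec_node, KStructure.Sat]
  refl i := by rw [valuation_eqIndex]
  eucl i j k := by
    simp only [valuation_eqIndex]
    exact fun h1 h2 => h1.symm.trans h2
  succ i j := by
    simp only [valuation_eqIndex, elemOf_succ]
    exact fun h => by rw [h]
  add i i' j j' := by
    simp only [valuation_eqIndex, elemOf_add]
    exact fun h h' => by rw [h, h']
  mul i i' j j' := by
    simp only [valuation_eqIndex, elemOf_mul]
    exact fun h h' => by rw [h, h']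
  ax p m a h := by
    rw [valuation_pair]
    exact hR p m h _
  target := by
    rw [← Bool.not_eq_true, valuation_pair, assign_zero, decForm_code]
    exact hφ

end ElemOf

/-! ### From truth valuations to models -/

section Model

open FirstOrder.Language

variable {R : ℕ → ℕ → Bool} {n : ℕ} {v : ℕ → Bool} (hv : IsTruth R n v)

/-- Names are identified if the valuation makes them equal. -/
def nameSetoid : Setoid ℕ where
  r i j := v (eqIndex i j) = true
  iseqv :=
    ⟨hv.refl, fun h => hv.eucl _ _ _ h (hv.refl _),
      fun h h' => hv.eucl _ _ _ (hv.eucl _ _ _ h (hv.refl _)) h'⟩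

/-- The model of named elements described by a truth valuation. -/
def nameModel : KStructure langPA where
  carrier := Quotient (nameSetoid hv)
  nonempty := ⟨Quotient.mk _ 0⟩
  str :=
    { funMap := fun {_} f =>
        match f with
        | PAFunc.zero => fun _ => Quotient.mk _ (Nat.pair 1 0)
        | PAFunc.succ => fun xs => Quotient.map (Nat.pair 2) (fun _ _ => hv.succ _ _) (xs 0)
        | PAFunc.add => fun xs => Quotient.map₂ (fun i j => Nat.pair 3 (Nat.pair i j))
            (fun _ _ h _ _ h' => hv.add _ _ _ _ h h') (xs 0) (xs 1)
        | PAFunc.mul => fun xs => Quotient.map₂ (fun i j => Nat.pair 4 (Nat.pair i j))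
            (fun _ _ h _ _ h' => hv.mul _ _ _ _ h h') (xs 0) (xs 1)
      RelMap := fun {_} R _ => R.elim }
  known := {φ | v (Nat.pair (Nat.pair 4 (code φ)) 0) = true}

/-- The element denoted by a name. -/
def nameMk (i : ℕ) : (nameModel hv).carrier := Quotient.mk (nameSetoid hv) i

theorem nameMk_eq_iff (i j : ℕ) : nameMk hv i = nameMk hv j ↔ v (eqIndex i j) = true :=
  Quotient.eq (r := nameSetoid hv)

theorem nameMk_surjective (d : (nameModel hv).carrier) : ∃ i, nameMk hv i = d :=
  Quotient.exists_rep d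

theorem update_nameMk (a x i : ℕ) :
    Function.update (fun y => nameMk hv (getVar a y)) x (nameMk hv i) =
      fun y => nameMk hv (getVar (updVar a x i) y) := by
  ext y
  simp only [getVar_updVar, Function.update_apply]
  split_ifs <;> rfl

theorem realize_nameModel (a : ℕ) (t : PATerm) :
    t.realize (fun y => nameMk hv (getVar a y)) = nameMk hv (substTerm a (codeTerm t)) := by
  induction t using term_induction with
  | var x => simp [realize_v, substTerm, codeRec_leaf]
  | zero =>
    rw [realize_zero]
    simp only [codeTerm_zero, substTerm, ne_eq, one_ne_zero, not_false_eq_true, codeRec_node]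
    rfl
  | succ t ht =>
    rw [realize_succ, ht]
    simp [substTerm, codeRec_node]
    rfl
  | add t u ht hu =>
    rw [realize_add, ht, hu]
    simp [substTerm, codeRec_node]
    rfl
  | mul t u ht hu =>
    rw [realize_mul, ht, hu]
    simp [substTerm, codeRec_node]
    rfl

/-- Truth in the model of names is what the valuation says; the condition `IsTruth.wit` is what
makes the quantifier step work, as every element of the model has a name. -/
theorem sat_nameModel (φ : Form) (a : ℕ) :
    (nameModel hv).Sat (fun y => nameMk hv (getVar a y)) φ ↔ v (Nat.pair (code φ) a) = true := by
  induction φ using form_induction generalizing a with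
  | falsum => simp [KStructure.Sat, code, hv.falsum]
  | equal t u =>
    simp only [KStructure.Sat, code, hv.equal]
    rw [realize_nameModel, realize_nameModel, nameMk_eq_iff]
  | imp φ ψ h1 h2 =>
    simp only [KStructure.Sat, code, hv.imp, h1, h2]
    cases v (Nat.pair (code φ) a) <;> simp
  | all x φ h =>
    simp only [KStructure.Sat, code]
    constructor
    · intro hs
      refine hv.wit _ _ _ ?_
      rw [← h, ← update_nameMk]
      exact hs _
    · intro hs d
      obtain ⟨i, rfl⟩ := nameMk_surjective hv d
      rw [update_nameMk, h]
      exact hv.inst _ _ _ _ hs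
  | know φ =>
    simp only [KStructure.Sat, code]
    exact ⟨hv.know _ _ _, hv.know _ _ _⟩

theorem exists_realize_bound (t : PATerm) : ∃ B, ∀ (M : KStructure langPA) (s s' : ℕ → M.carrier),
    (∀ x < B, s x = s' x) → t.realize s = t.realize s' := by
  induction t using term_induction with
  | var x => exact ⟨x + 1, fun M s s' h => h x (by omega)⟩
  | zero => exact ⟨0, fun M s s' _ => by rw [realize_zero, realize_zero]⟩
  | succ t ht =>
    obtain ⟨B, hB⟩ := ht
    exact ⟨B, fun M s s' h => by rw [realize_succ, realize_succ, hB M s s' h]⟩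
  | add t u ht hu =>
    obtain ⟨B, hB⟩ := ht
    obtain ⟨C, hC⟩ := hu
    exact ⟨max B C, fun M s s' h => by
      rw [realize_add, realize_add, hB M s s' fun x hx => h x (lt_max_of_lt_left hx),
        hC M s s' fun x hx => h x (lt_max_of_lt_right hx)]⟩
  | mul t u ht hu =>
    obtain ⟨B, hB⟩ := ht
    obtain ⟨C, hC⟩ := hu
    exact ⟨max B C, fun M s s' h => by
      rw [realize_mul, realize_mul, hB M s s' fun x hx => h x (lt_max_of_lt_left hx),
        hC M s s' fun x hx => h x (lt_max_of_lt_right hx)]⟩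

/-- Truth of a formula depends on finitely many variables only. -/
theorem exists_sat_bound (φ : Form) : ∃ B, ∀ (M : KStructure langPA) (s s' : ℕ → M.carrier),
    (∀ x < B, s x = s' x) → (M.Sat s φ ↔ M.Sat s' φ) := by
  induction φ using form_induction with
  | falsum => exact ⟨0, fun _ _ _ _ => Iff.rfl⟩
  | equal t u =>
    obtain ⟨B, hB⟩ := exists_realize_bound t
    obtain ⟨C, hC⟩ := exists_realize_bound u
    refine ⟨max B C, fun M s s' h => ?_⟩
    simp only [KStructure.Sat]
    rw [hB M s s' fun x hx => h x (lt_max_of_lt_left hx),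
      hC M s s' fun x hx => h x (lt_max_of_lt_right hx)]
  | imp φ ψ hφ hψ =>
    obtain ⟨B, hB⟩ := hφ
    obtain ⟨C, hC⟩ := hψ
    refine ⟨max B C, fun M s s' h => ?_⟩
    simp only [KStructure.Sat]
    rw [hB M s s' fun x hx => h x (lt_max_of_lt_left hx),
      hC M s s' fun x hx => h x (lt_max_of_lt_right hx)]
  | all y φ hφ =>
    obtain ⟨B, hB⟩ := hφ
    refine ⟨B, fun M s s' h => forall_congr' fun d => hB M _ _ fun x hx => ?_⟩
    simp only [Function.update_apply]
    split_ifs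
    · rfl
    · exact h x hx
  | know φ => exact ⟨0, fun _ _ _ _ => Iff.rfl⟩

theorem exists_getVar_eq (s : ℕ → (nameModel hv).carrier) (B : ℕ) :
    ∃ a, ∀ x < B, nameMk hv (getVar a x) = s x := by
  induction B with
  | zero => exact ⟨0, fun x hx => by omega⟩
  | succ B ih =>
    obtain ⟨a, ha⟩ := ih
    obtain ⟨i, hi⟩ := nameMk_surjective hv (s B)
    refine ⟨updVar a B i, fun x hx => ?_⟩
    rw [getVar_updVar, Function.update_apply]
    split_ifs with h
    · rw [hi, h]
    · exact ha x (by omega)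

/-- Every assignment agrees on the variables of a formula with one that has a code. -/
theorem models_nameModel {φ : Form} (h : ∀ a, v (Nat.pair (code φ) a) = true) :
    (nameModel hv).Models φ := by
  intro s
  obtain ⟨B, hB⟩ := exists_sat_bound φ
  obtain ⟨a, ha⟩ := exists_getVar_eq hv s B
  exact (hB _ _ _ ha).1 ((sat_nameModel hv φ a).2 (h a))

end Model

/-- The semantic form of the completeness theorem: consequence is the unsatisfiability of the
conditions on a truth valuation. -/
theorem entails_iff {T : Set Form} {R : ℕ → ℕ → Bool}
    (hR : ∀ n, (∃ ψ, code ψ = n ∧ ψ ∈ T) ↔ ∃ m, R n m = true) (φ : Form) :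
    Entails T φ ↔ ¬∃ v, IsTruth R (code φ) v := by
  constructor
  · rintro h ⟨v, hv⟩
    have hM : (nameModel hv).ModelsAll T := by
      intro ψ hψ
      obtain ⟨m, hm⟩ := (hR (code ψ)).1 ⟨ψ, rfl, hψ⟩
      exact models_nameModel hv fun a => hv.ax _ _ _ hm
    have := (sat_nameModel hv φ 0).1 (h _ hM _)
    rw [hv.target] at this
    exact Bool.false_ne_true this
  · intro h M hM s
    by_contra hs
    refine h ⟨_, isTruth_valuation s (fun p m hpm => ?_) hs⟩
    obtain ⟨ψ, rfl, hψ⟩ := (hR p).2 ⟨m, hpm⟩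
    rw [decForm_code]
    exact hM ψ hψ

theorem sigmaOne_entails {T : Set Form} (hT : SigmaOne fun n => ∃ ψ, code ψ = n ∧ ψ ∈ T) :
    SigmaOne fun n => ∃ φ, code φ = n ∧ Entails T φ := by
  obtain ⟨R, hR, hT⟩ := hT
  refine ((SigmaOne.of_primrec (primrec_isForm true Primrec.id)).and
    (sigmaOne_not_exists_isTruth hR)).of_eq fun n => ?_
  rw [id, isForm_iff]
  constructor
  · rintro ⟨φ, rfl, h⟩
    exact ⟨⟨φ, Or.inl rfl, rfl⟩, (entails_iff hT φ).1 h⟩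
  · rintro ⟨⟨φ, _, rfl⟩, h⟩
    exact ⟨φ, rfl, (entails_iff hT φ).2 h⟩

/-! ### The theory `Σ` is recursively enumerable -/

/-- The Gödel numbers of the elements of `S` form a `Σ₁` set. -/
def SigmaOneSet (S : Set Form) : Prop := SigmaOne fun n => ∃ φ, code φ = n ∧ φ ∈ S

namespace SigmaOneSet

variable {S S' : Set Form}

theorem union (h : SigmaOneSet S) (h' : SigmaOneSet S') : SigmaOneSet (S ∪ S') :=
  (SigmaOne.or h h').of_eq fun n => by
    simp only [Set.mem_union, and_or_left, exists_or]

theorem singleton (φ : Form) : SigmaOneSet {φ} :=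
  (SigmaOne.of_primrec (f := fun n => decide (code φ = n)) (by fun_prop)).of_eq fun n => by simp

theorem know (h : SigmaOneSet S) : SigmaOneSet (KFormula.know '' S) := by
  refine ((SigmaOne.of_primrec (f := fun n => decide (Nat.pair 4 n.unpair.2 = n))
    (by fun_prop)).and (h.comp (f := fun n => n.unpair.2) (by fun_prop))).of_eq fun n => ?_
  simp only [decide_eq_true_eq]
  constructor
  · rintro ⟨_, rfl, φ, hφ, rfl⟩
    exact ⟨by simp [code], φ, by simp [code], hφ⟩
  · rintro ⟨hn, φ, hφ, hS⟩
    exact ⟨.know φ, by rw [code, hφ, hn], φ, hS, rfl⟩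

/-- A set of formulas is `Σ₁` if its Gödel numbers are the values of a primitive recursive function
on a `Σ₁` set. -/
theorem of_range {P : ℕ → Prop} (hP : SigmaOne P) {f : ℕ → ℕ} (hf : Primrec f)
    (h : ∀ n, (∃ φ, code φ = n ∧ φ ∈ S) ↔ ∃ w, P w ∧ f w = n) : SigmaOneSet S := by
  refine SigmaOne.of_eq (SigmaOne.exists_pair (P := fun k => P k.unpair.2 ∧
    decide (f k.unpair.2 = k.unpair.1) = true) ((hP.comp (by fun_prop)).and
      (SigmaOne.of_primrec (by fun_prop)))) fun n => ?_
  simpa using h n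

end SigmaOneSet

/-- The Gödel number of the induction formula for the variable `x` and the formula coded by `p`. -/
def indCode (x p : ℕ) : ℕ :=
  Nat.pair 2 (Nat.pair (substForm x (Nat.pair 1 0) p)
    (Nat.pair 2 (Nat.pair
      (Nat.pair 3 (Nat.pair x
        (Nat.pair 2 (Nat.pair p (substForm x (Nat.pair 2 (Nat.pair 0 x)) p)))))
      (Nat.pair 3 (Nat.pair x p)))))

@[fun_prop]
theorem primrec_indCode {α : Type*} [Primcodable α] {f g : α → ℕ} (hf : Primrec f)
    (hg : Primrec g) : Primrec fun a => indCode (f a) (g a) := by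
  unfold indCode; fun_prop

theorem code_induction_eq_indCode (x : ℕ) (φ : Form) :
    code (induction x φ) = indCode x (code φ) := by
  rw [indCode, ← codeTerm_zero, ← codeTerm_v, ← codeTerm_succ, substForm_code, substForm_code]
  simp only [induction, code]

/-- Whether every free variable of the formula code `n` is in the list coded by `l`. -/
def coversFree (l n : ℕ) : Bool :=
  decide (∀ y < n + 1, (!occForm y n || memList y l) = true)

theorem coversFree_code (l : ℕ) (φ : Form) :
    coversFree l (code φ) = true ↔ φ.freeVars ⊆ (decList l).toFinset := by
  have h : ∀ y, (!occForm y (code φ) || memList y l) = true ↔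
      (y ∈ φ.freeVars → y ∈ decList l) := by
    intro y
    rw [← occForm_code, ← memList_iff]
    cases occForm y (code φ) <;> simp
  rw [coversFree, decide_eq_true_eq]
  simp only [h, Finset.subset_iff, List.mem_toFinset]
  exact ⟨fun H y hy => H y (Nat.lt_succ_of_le (le_of_occForm ((occForm_code y φ).2 hy))) hy,
    fun H y _ => H (x := y)⟩

@[fun_prop]
theorem primrec_coversFree {α : Type*} [Primcodable α] {f g : α → ℕ} (hf : Primrec f)
    (hg : Primrec g) : Primrec fun a => coversFree (f a) (g a) := by
  have h1 : PrimrecRel fun (y : ℕ) (q : ℕ × ℕ) => (!occForm y q.2 || memList y q.1) = true :=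
    PrimrecRel.comp Primrec.eq (by fun_prop) (Primrec.const true)
  have h2 := primrecRel_forall_lt h1
  have h3 : PrimrecPred fun q : ℕ × ℕ =>
      ∀ y < q.2 + 1, (!occForm y q.2 || memList y q.1) = true :=
    h2.comp (f := fun q : ℕ × ℕ => q.2 + 1) (g := fun q => q) (by fun_prop) Primrec.id
  exact h3.decide.comp (hf.pair hg)

theorem sigmaOneSet_induction : SigmaOneSet {ψ | ∃ (x : ℕ) (φ : Form) (xs : List ℕ), φ.KFree ∧
    (induction x φ).freeVars ⊆ xs.toFinset ∧ ψ = KFormula.allList xs (induction x φ)} := by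
  refine SigmaOneSet.of_range
    (P := fun w => (isForm false w.unpair.2.unpair.1 && coversFree w.unpair.2.unpair.2
      (indCode w.unpair.1 w.unpair.2.unpair.1)) = true) (SigmaOne.of_primrec (by fun_prop))
    (f := fun w => closeForm (indCode w.unpair.1 w.unpair.2.unpair.1) w.unpair.2.unpair.2)
    (by fun_prop) fun n => ?_
  simp only [Bool.and_eq_true]
  constructor
  · rintro ⟨_, rfl, x, φ, xs, hφ, hxs, rfl⟩
    obtain ⟨l, rfl⟩ := decList_surjective xs
    refine ⟨Nat.pair x (Nat.pair (code φ) l), ?_⟩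
    simp only [Nat.unpair_pair, ← code_induction_eq_indCode, closeForm_code, coversFree_code,
      and_true]
    exact ⟨(isForm_iff _ _).2 ⟨φ, Or.inr hφ, rfl⟩, hxs⟩
  · rintro ⟨w, ⟨hp, hc⟩, rfl⟩
    obtain ⟨φ, hφ, hp⟩ := (isForm_iff _ _).1 hp
    rw [← hp, ← code_induction_eq_indCode, coversFree_code] at hc
    rw [← hp, ← code_induction_eq_indCode, closeForm_code]
    exact ⟨_, rfl, w.unpair.1, φ, _, by simpa using hφ, hc, rfl⟩

open KFormula PATerm in
theorem sigmaOneSet_isPAAxiom : SigmaOneSet {φ | IsPAAxiom φ} := by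
  have h := ((((((SigmaOneSet.singleton (all 0 (neg (equal (succ (v 0)) zero)))).union
    (.singleton (all 0 (all 1 (imp (equal (succ (v 0)) (succ (v 1))) (equal (v 0) (v 1))))))).union
    (.singleton (all 0 (equal (add (v 0) zero) (v 0))))).union
    (.singleton (all 0 (all 1 (equal (add (v 0) (succ (v 1))) (succ (add (v 0) (v 1)))))))).union
    (.singleton (all 0 (equal (mul (v 0) zero) zero)))).union
    (.singleton (all 0 (all 1
      (equal (mul (v 0) (succ (v 1))) (add (mul (v 0) (v 1)) (v 0))))))).union
    sigmaOneSet_induction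
  refine (congrArg SigmaOneSet ?_).mp h
  ext φ
  constructor
  · rintro ((((((h | h) | h) | h) | h) | h) | ⟨x, φ, xs, hφ, hxs, rfl⟩)
    · exact h ▸ IsPAAxiom.succ_ne_zero
    · exact h ▸ IsPAAxiom.succ_inj
    · exact h ▸ IsPAAxiom.add_zero
    · exact h ▸ IsPAAxiom.add_succ
    · exact h ▸ IsPAAxiom.mul_zero
    · exact h ▸ IsPAAxiom.mul_succ
    · exact IsPAAxiom.ind x φ hφ xs hxs
  · intro h
    cases h with
    | ind x φ hφ xs hxs => exact Or.inr ⟨x, φ, xs, hφ, hxs, rfl⟩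
    | _ => simp

theorem sigmaOneSet_tautology : SigmaOneSet {φ | Tautology φ} := by
  have h0 : SigmaOneSet (∅ : Set Form) :=
    (SigmaOne.of_primrec (Primrec.const false)).of_eq fun n => by simp
  refine (sigmaOne_entails h0).of_eq fun n => exists_congr fun φ => and_congr_right fun _ => ?_
  exact ⟨fun h M _ => h M, fun h M => h M fun _ hψ => absurd hψ (Set.notMem_empty _)⟩

theorem sigmaOneSet_modusPonens : SigmaOneSet {χ | ∃ φ ψ : Form,
    χ = .imp (.know (.imp φ ψ)) (.imp (.know φ) (.know ψ))} := by
  refine SigmaOneSet.of_range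
    (P := fun w => (isForm true w.unpair.1 && isForm true w.unpair.2) = true)
    (SigmaOne.of_primrec (by fun_prop))
    (f := fun w => Nat.pair 2 (Nat.pair (Nat.pair 4 (Nat.pair 2 w))
      (Nat.pair 2 (Nat.pair (Nat.pair 4 w.unpair.1) (Nat.pair 4 w.unpair.2)))))
    (by fun_prop) fun n => ?_
  simp only [Bool.and_eq_true, isForm_iff]
  constructor
  · rintro ⟨_, rfl, φ, ψ, rfl⟩
    exact ⟨Nat.pair (code φ) (code ψ), by simp [code]⟩
  · rintro ⟨w, ⟨⟨φ, _, hφ⟩, ψ, _, hψ⟩, rfl⟩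
    exact ⟨_, by simp [code, hφ, hψ], φ, ψ, rfl⟩

theorem sigmaOneSet_factivity :
    SigmaOneSet {χ | ∃ φ : Form, χ = .imp (.know φ) φ} := by
  refine SigmaOneSet.of_range (P := fun w => isForm true w = true)
    (SigmaOne.of_primrec (by fun_prop)) (f := fun w => Nat.pair 2 (Nat.pair (Nat.pair 4 w) w))
    (by fun_prop) fun n => ?_
  simp only [isForm_iff]
  constructor
  · rintro ⟨_, rfl, φ, rfl⟩
    exact ⟨code φ, by simp [code]⟩
  · rintro ⟨w, ⟨φ, _, hφ⟩, rfl⟩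
    exact ⟨_, by simp [code, hφ], φ, rfl⟩

theorem sigmaOneSet_isBasicAxiom : SigmaOneSet {φ | IsBasicAxiom φ} := by
  refine (congrArg SigmaOneSet ?_).mp ((sigmaOneSet_tautology.know.union
    sigmaOneSet_modusPonens).union sigmaOneSet_isPAAxiom.know)
  ext φ
  constructor
  · rintro ((⟨φ, h, rfl⟩ | ⟨φ, ψ, rfl⟩) | ⟨φ, h, rfl⟩)
    · exact .tautology φ h
    · exact .modusPonens φ ψ
    · exact .arithmetic φ h
  · rintro (⟨φ, h⟩ | ⟨φ, ψ⟩ | ⟨φ, h⟩)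
    · exact Or.inl (Or.inl ⟨φ, h, rfl⟩)
    · exact Or.inl (Or.inr ⟨φ, ψ, rfl⟩)
    · exact Or.inr ⟨φ, h, rfl⟩

theorem sigmaOneSet_knowingPA : SigmaOneSet knowingPA := by
  refine (congrArg SigmaOneSet ?_).mp (((sigmaOneSet_isBasicAxiom.union
    sigmaOneSet_isBasicAxiom.know).union sigmaOneSet_factivity).union sigmaOneSet_isPAAxiom)
  refine congrArg (· ∪ {φ | IsPAAxiom φ}) ?_
  ext φ
  constructor
  · rintro ((h | ⟨φ, h, rfl⟩) | ⟨φ, rfl⟩)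
    · exact .basic φ h
    · exact .closure φ h
    · exact .factivity φ
  · rintro (⟨φ, h⟩ | ⟨φ, h⟩ | ⟨φ⟩)
    · exact Or.inl (Or.inl h)
    · exact Or.inl (Or.inr ⟨φ, h, rfl⟩)
    · exact Or.inr ⟨φ, rfl⟩

/-! ### Truth of the axioms of Peano arithmetic in standard structures -/

theorem models_know {L : FirstOrder.Language.{0, 0}} (M : KStructure L) (φ : KFormula L) :
    M.Models φ.know ↔ φ ∈ M.known :=
  ⟨fun h => h fun _ => Classical.choice M.nonempty, fun h _ => h⟩

theorem models_allList {L : FirstOrder.Language.{0, 0}} {M : KStructure L} {φ : KFormula L}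
    (h : M.Models φ) (xs : List ℕ) : M.Models (KFormula.allList xs φ) := by
  induction xs with
  | nil => exact h
  | cons x xs ih => exact fun s a => ih _

/-- The substitution lemma for a term `t` in which no variable other than `x` occurs. -/
theorem sat_subst {L : FirstOrder.Language.{0, 0}} (M : KStructure L) {x : ℕ} {t : L.Term ℕ}
    (ht : ∀ s s' : ℕ → M.carrier, s x = s' x → t.realize s = t.realize s') (φ : KFormula L)
    (s : ℕ → M.carrier) :
    M.Sat s (φ.subst x t) ↔ M.Sat (Function.update s x (t.realize s)) φ := by
  have hterm : ∀ (s : ℕ → M.carrier) (u : L.Term ℕ),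
      (u.subst (Function.update FirstOrder.Language.Term.var x t)).realize s =
        u.realize (Function.update s x (t.realize s)) := by
    intro s u
    rw [FirstOrder.Language.Term.realize_subst]
    congr 1
    ext y
    simp only [Function.update_apply]
    split_ifs <;> rfl
  induction φ generalizing s with
  | falsum => exact Iff.rfl
  | equal t₁ t₂ => simp only [KFormula.subst, KStructure.Sat, hterm]
  | rel R ts => simp only [KFormula.subst, KStructure.Sat, hterm]
  | imp φ ψ hφ hψ => simp only [KFormula.subst, KStructure.Sat, hφ, hψ]
  | all y φ hφ =>
    simp only [KFormula.subst, KStructure.Sat]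
    refine forall_congr' fun a => ?_
    split_ifs with h
    · rw [h, Function.update_idem]
    · refine (hφ _).trans ?_
      rw [Function.update_comm h,
        ht (Function.update s y a) s (Function.update_of_ne (Ne.symm h) _ _)]
  | know φ => exact Iff.rfl

theorem models_induction (k : Set Form) (x : ℕ) (φ : Form) :
    (standard k).Models (induction x φ) := by
  intro s
  simp only [induction, KStructure.Sat]
  rw [sat_subst _ fun s s' _ => by rw [realize_zero, realize_zero]]
  intro h0 hS a
  induction a with
  | zero => exact h0
  | succ a ih =>
    have := hS a ih
    rw [sat_subst _ fun s s' h => by rw [realize_succ, realize_succ, realize_v, realize_v, h]]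
      at this
    rw [Function.update_idem, realize_succ, realize_v, Function.update_self] at this
    exact this

theorem models_of_isPAAxiom (k : Set Form) {φ : Form} (h : IsPAAxiom φ) :
    (standard k).Models φ := by
  intro s
  cases h with
  | ind x φ hφ xs hxs => exact models_allList (models_induction k x φ) xs s
  | _ =>
    simp only [KFormula.neg, KStructure.Sat, realize_v, realize_zero, realize_succ, realize_add,
      realize_mul, FirstOrder.Language.Structure.funMap, Matrix.cons_val_zero, Matrix.cons_val_one,
      Function.update_apply]
    intros
    grind

/-! ### The structure `Slash(Σ)` -/

theorem sat_slash (T : Set Form) (φ : Form) (s : ℕ → ℕ) :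
    (slash T).Sat s φ ↔ slashSat T s φ := by
  induction φ using form_induction generalizing s with
  | falsum => simp only [slashSat, KStructure.Sat]
  | equal t u => simp only [slashSat, KStructure.Sat]; rfl
  | imp φ ψ hφ hψ => simp only [slashSat, KStructure.Sat, hφ, hψ]
  | all x φ hφ => simp only [slashSat, KStructure.Sat, ← hφ]; rfl
  | know φ => simp only [slashSat, KStructure.Sat]; rfl

theorem slash_models_know (T : Set Form) (φ : Form) :
    (slash T).Models φ.know ↔ (slash T).Models φ ∧ Entails T φ := by
  rw [models_know]
  exact and_congr_left fun _ => forall_congr' fun s => (sat_slash T φ s).symm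

/-- A standard structure that obeys the defining equivalence of `Slash(T)` has the same true
formulas, by induction on the formula. -/
theorem standard_eq_slash {T k : Set Form}
    (h : ∀ φ : Form, (standard k).Models φ.know ↔ (standard k).Models φ ∧ Entails T φ) :
    standard k = slash T := by
  have hs : ∀ (φ : Form) (s : ℕ → ℕ), (standard k).Sat s φ ↔ slashSat T s φ := by
    intro φ
    induction φ using form_induction with
    | falsum => intro s; simp only [slashSat, KStructure.Sat]
    | equal t u => intro s; simp only [slashSat, KStructure.Sat]
    | imp φ ψ hφ hψ => intro s; simp only [slashSat, KStructure.Sat, hφ, hψ]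
    | all x φ hφ => intro s; simp only [slashSat, KStructure.Sat, hφ]
    | know φ hφ =>
      intro s
      refine ((models_know _ φ).symm.trans (h φ)).trans ?_
      exact and_congr_left fun _ => forall_congr' hφ
  refine congrArg standard (Set.ext fun φ => ?_)
  exact ((models_know _ φ).symm.trans (h φ)).trans
    (and_congr_left fun _ => forall_congr' (hs φ))

theorem entails_of_mem {T : Set Form} {φ : Form} (h : φ ∈ T) : Entails T φ :=
  fun _ hM => hM φ h

theorem slash_models_isBasicAxiom {φ : Form} (h : IsBasicAxiom φ) :
    (slash knowingPA).Models φ := by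
  cases h with
  | tautology φ h => exact (slash_models_know _ _).2 ⟨h _, fun M _ => h M⟩
  | modusPonens φ ψ =>
    intro s h1 h2
    obtain ⟨h1, h1'⟩ := (slash_models_know _ _).1 ((models_know _ _).2 h1)
    obtain ⟨h2, h2'⟩ := (slash_models_know _ _).1 ((models_know _ _).2 h2)
    exact (slash_models_know _ _).2
      ⟨fun s => h1 s (h2 s), fun M hM s => h1' M hM s (h2' M hM s)⟩ s
  | arithmetic φ h =>
    exact (slash_models_know _ _).2 ⟨models_of_isPAAxiom _ h, entails_of_mem (Or.inr h)⟩

theorem slash_models_factivity (T : Set Form) (φ : Form) :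
    (slash T).Models (.imp (.know φ) φ) :=
  fun s h => ((slash_models_know _ _).1 ((models_know _ _).2 h)).1 s

theorem slash_modelsAll : (slash knowingPA).ModelsAll knowingPA := by
  rintro φ (h | h)
  · cases h with
    | basic φ h => exact slash_models_isBasicAxiom h
    | closure φ h =>
      exact (slash_models_know _ _).2
        ⟨slash_models_isBasicAxiom h, entails_of_mem (Or.inl (.basic φ h))⟩
    | factivity φ => exact slash_models_factivity _ φ
  · exact models_of_isPAAxiom _ h

/-- What `Σ` entails is true in `Slash(Σ)`, so the first half of the defining condition of `K(φ)`
is redundant. -/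
theorem slash_models_know_iff (φ : Form) :
    (slash knowingPA).Models φ.know ↔ Entails knowingPA φ :=
  (slash_models_know _ _).trans (and_iff_right_of_imp fun h => h _ slash_modelsAll)

theorem knownCodes_slash : knownCodes (slash knowingPA) = consequenceCodes knowingPA :=
  Set.ext fun _ => exists_congr fun φ => and_congr_right fun _ => slash_models_know_iff φ

theorem rePred_consequenceCodes : REPred fun n : ℕ => n ∈ consequenceCodes knowingPA :=
  (sigmaOne_entails sigmaOneSet_knowingPA).rePred

end KnowingMachine

open KnowingMachine
theorem mainTheorem2 :
    -- `Slash(Σ)` is the unique standard structure obeying its inductive definition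
    (∀ M : KStructure langPA, IsStandard M →
      ((∀ φ : Form, M.Models φ.know ↔ (M.Models φ ∧ Entails knowingPA φ)) ↔
        M = slash knowingPA)) ∧
    (slash knowingPA).ModelsAll knowingPA ∧
    KnowsFactivity (slash knowingPA) ∧
    (∀ φ : Form, (slash knowingPA).Models φ.know ↔ Entails knowingPA φ) ∧
    knownCodes (slash knowingPA) = consequenceCodes knowingPA ∧
    (REPred fun n : ℕ => n ∈ consequenceCodes knowingPA) ∧
    IsKnowingMachine (slash knowingPA) := by
  refine ⟨?_, slash_modelsAll, fun φ => ?_, slash_models_know_iff, knownCodes_slash,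
    rePred_consequenceCodes, ⟨⟨_, rfl⟩, fun φ h => slash_modelsAll φ (Or.inl h)⟩, ?_⟩
  · rintro M ⟨k, rfl⟩
    refine ⟨standard_eq_slash, fun h => ?_⟩
    rw [h]
    exact slash_models_know _
  · exact (slash_models_know_iff _).2 (entails_of_mem (Or.inl (.factivity φ)))
  · rw [knownCodes_slash]
    exact rePred_consequenceCodes
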